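/- **Theorem (symmetric energy barrier of the cubic RBH model).** *Lattice.* Let $L_x,L_y\ge 1$, $L_z\ge 2$ be integers. Record a cell of the cubic lattice by the doubled coordinates $(x,y,z)\in\mathbb Z^3$ of its centre, so that its dimension is the number of odd coordinates. The lattice $\mathcal L$ consists of the cells with $0\le x\le 2L_x$, $0\le y\le 2L_y$, $1\le z\le 2L_z-1$, except the vertices and edges with $x=2L_x$; $V,E,F,Q$ denote its vertices, edges, faces and volumes. The facet $x=0$ is the toric code boundary, $x=2L_x$ the sink boundary, $y=0$ and $y=2L_y$ are primal boundaries (giving the two smooth edges of the toric code boundary), and the terminations at $z=0$ and $z=2L_z$ are dual boundaries (giving its two rough edges). There is a qubit on every edge in $E$ and on every face in $F$ with $x>0$. *Hamiltonian.* $$H=-\sum_{i:\,x(i)>0}K_i-\sum_{v\in V,\,x(v)=0}\overline A_v-\sum_{f\in F,\,x(f)=0}\overline B_f ,$$ where $i$ runs over the qubits off the toric code boundary, $K_f=X_f\prod_{e\subset f}Z_e$, $K_e=X_e\prod_{f\supset e}Z_f$, $\overline A_v=\prod_{e\ni v,\,x(e)=0}\bigl(X_e\prod_{f\supset e}Z_f\bigr)$,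 $\overline B_f=\prod_{e\subset f}Z_e$, and all products are over sites that carry a qubit. The 1-form symmetry group is $G=\langle S_v,S_q : v\in V,\ q\in Q\rangle$ with $S_v=\prod_{e\ni v}X_e$ and $S_q=\prod_{f\subset q}X_f$. *Barrier.* A logical operator is a Pauli operator that preserves the ground space of $H$ and does not act on it as a scalar. Fix a range $r\in\mathbb N$. A symmetric local decomposition of a logical operator $\overline l$ is a finite sequence of Pauli operators $l^{(1)}=I,\dots,l^{(N)}=\overline l$, each commuting with $G$, such that $l^{(k+1)}=P_k\,l^{(k)}$ with $P_k$ a Pauli operator supported on qubits whose positions differ pairwise by at most $r$ lattice spacings in every coordinate. Let $E_0$ be the ground energy and $E^{(k)}$ the energy of $l^{(k)}|\psi_0\rangle$ for any ground state $|\psi_0\rangle$. The symmetric energy barrier is $$\Delta_G=\inf_{\overline l}\ \inf_{(l^{(k)})}\ \max_k\,\bigl(E^{(k)}-E_0\bigr).$$ *Width.* $d=\min\{d_Z,d_X,d_{\rm cond}\}$, where $d_Z$ is the lattice distance between the two rough edges of the toric code boundary (the least number of edges of a path joining them), $d_X$ is the distance between its two smooth edges on the dual of the boundary lattice (the least number of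 edges crossed), and $d_{\rm cond}$ is the lattice distance between the toric code boundary and the sink boundary. *Claim.* For every $r$ there is a constant $r'$, depending only on $r$ and not on $L_x,L_y,L_z$, such that for all $L_x,L_y\ge1$, $L_z\ge2$ the energy gap $\Delta_{\rm gap}$ of $H$ (its smallest excitation energy) equals $2$ and $$\Delta_G\ \ge\ d\cdot\frac{\Delta_{\rm gap}}{2}-r' .$$ In particular the barrier grows linearly with the system size: for $L_x=L_y=L_z=n\ge2$ one has $\Delta_G\ge n\,\Delta_{\rm gap}/2-r'$. -/

import Mathlib

noncomputable section

namespace RBH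

/-!
Cells of the cubic lattice are recorded by the doubled coordinates `(x, y, z)` of their centres:
an odd coordinate is a direction in which the cell extends, so the dimension of a cell is the
number of its odd coordinates.
-/

/-- A cell of the ambient cubic lattice, given by the doubled coordinates of its centre. -/
abbrev Cell := ℤ × ℤ × ℤ

/-- The number of directions in which a cell extends. -/
abbrev cellDim (c : Cell) : ℤ := c.1 % 2 + c.2.1 % 2 + c.2.2 % 2

/-- `a ⊂ b`: the cell `a` is contained in (the closure of) the cell `b`. -/
abbrev Inside (a b : Cell) : Prop :=
  (a.1 = b.1 ∨ (Odd b.1 ∧ |a.1 - b.1| = 1)) ∧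
  (a.2.1 = b.2.1 ∨ (Odd b.2.1 ∧ |a.2.1 - b.2.1| = 1)) ∧
  (a.2.2 = b.2.2 ∨ (Odd b.2.2 ∧ |a.2.2 - b.2.2| = 1))

/-- The numbers of 3-cells of the lattice in the three coordinate directions. -/
structure Dims where
  x : ℕ
  y : ℕ
  z : ℕ

/-! ### The lattice

The toric code facet is `x = 0` and the sink facet is `x = 2 * L.x`; the two primal facets are
`y = 0` and `y = 2 * L.y` (lattice terminated smoothly); the two dual facets are at `z = 0` and
`z = 2 * L.z`, where the lattice is terminated such that all the cells lying in these two planes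
are absent, and the edges, faces and volumes that touch them are kept.
On the sink facet there are boundary faces, but no boundary edges and no boundary vertices.
-/

/-- All cell positions of the box, before the termination at the sink facet. -/
def box (L : Dims) : Finset Cell :=
  Finset.Icc (0 : ℤ) (2 * L.x) ×ˢ Finset.Icc (0 : ℤ) (2 * L.y) ×ˢ Finset.Icc (1 : ℤ) (2 * L.z - 1)

/-- The vertices `V`. -/
def vertices (L : Dims) : Finset Cell :=
  (box L).filter fun c => cellDim c = 0 ∧ c.1 < 2 * L.x

/-- The edges `E`. -/
def edges (L : Dims) : Finset Cell :=
  (box L).filter fun c => cellDim c = 1 ∧ c.1 < 2 * L.x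

/-- The faces `F`. -/
def faces (L : Dims) : Finset Cell :=
  (box L).filter fun c => cellDim c = 2

/-- The volumes `Q`. -/
def cubes (L : Dims) : Finset Cell :=
  (box L).filter fun c => cellDim c = 3

/-- The sites that carry a qubit: every edge, and every face that does not lie in the toric code
facet. -/
def qubitSites (L : Dims) : Finset Cell :=
  edges L ∪ (faces L).filter fun c => 0 < c.1

/-- The qubits: dual qubits on edges and primal qubits on faces. -/
abbrev Qubit (L : Dims) := {c : Cell // c ∈ qubitSites L}

/-! ### Pauli operators -/

/-- Computational basis labels. -/
abbrev Config (L : Dims) := Qubit L → ZMod 2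

/-- The state space `⨂ ℂ²`, a state being given by its amplitudes in the computational basis. -/
abbrev QState (L : Dims) := Config L → ℂ

/-- Operators on the state space. -/
abbrev Op (L : Dims) := Module.End ℂ (QState L)

/-- The product of the Pauli operators `X_i` over `i ∈ A`. -/
def opX {L : Dims} (A : Finset (Qubit L)) : Op L where
  toFun ψ := fun s => ψ fun i => if i ∈ A then s i + 1 else s i
  map_add' _ _ := rfl
  map_smul' _ _ := rfl

/-- The product of the Pauli operators `Z_i` over `i ∈ A`. -/
def opZ {L : Dims} (A : Finset (Qubit L)) : Op L where
  toFun ψ := fun s => (∏ i ∈ A, if s i = 0 then (1 : ℂ) else -1) * ψ s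
  map_add' _ _ := by funext s; simp [mul_add]
  map_smul' _ _ := by funext s; simp [mul_left_comm]

/-- `P` is a Pauli operator with support in `A`. -/
def IsPauliOn {L : Dims} (A : Finset (Qubit L)) (P : Op L) : Prop :=
  ∃ (c : ℂ) (B C : Finset (Qubit L)), c ^ 4 = 1 ∧ B ⊆ A ∧ C ⊆ A ∧ P = c • (opX B * opZ C)

/-- `P` is a Pauli operator. -/
def IsPauli {L : Dims} (P : Op L) : Prop := IsPauliOn Finset.univ P

/-- `P` is a Pauli operator of range at most `r` (in units of the lattice spacing): it is
supported on qubits whose positions differ by at most `r` in each of the three coordinates. -/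
def IsLocalPauli {L : Dims} (r : ℕ) (P : Op L) : Prop :=
  ∃ A : Finset (Qubit L), IsPauliOn A P ∧ ∀ i ∈ A, ∀ j ∈ A,
    |i.1.1 - j.1.1| ≤ 2 * r ∧ |i.1.2.1 - j.1.2.1| ≤ 2 * r ∧ |i.1.2.2 - j.1.2.2| ≤ 2 * r

/-! ### The Hamiltonian and the symmetry -/

/-- The neighbours of a qubit: for a face, the edges that it contains; for an edge, the faces
(carrying a qubit) that contain it. -/
def nbrs {L : Dims} (i : Qubit L) : Finset (Qubit L) :=
  Finset.univ.filter fun j => j ≠ i ∧ (Inside j.1 i.1 ∨ Inside i.1 j.1)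

/-- The (possibly truncated) cluster term `K_f` or `K_e`. -/
def clusterTerm {L : Dims} (i : Qubit L) : Op L := opX {i} * opZ (nbrs i)

/-- The edges of the toric code facet that contain `v`. -/
def toricStar {L : Dims} (v : Cell) : Finset (Qubit L) :=
  Finset.univ.filter fun e => cellDim e.1 = 1 ∧ e.1.1 = 0 ∧ Inside v e.1

/-- The dressed star term `A_v = ∏_{e ∋ v} X_e ∏_{f ⊃ e} Z_f`, with `e` in the toric code facet.
Each such `e` lies in exactly one face that carries a qubit, and these faces are distinct for
distinct `e`, so the faces involved are those that contain some edge of the star. -/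
def starTerm (L : Dims) (v : Cell) : Op L :=
  opX (toricStar v) *
    opZ (Finset.univ.filter fun f => cellDim f.1 = 2 ∧ ∃ e ∈ toricStar (L := L) v, Inside e.1 f.1)

/-- The plaquette term `B_f = ∏_{e ⊂ f} Z_e` of a face `f` of the toric code facet. -/
def plaquetteTerm (L : Dims) (f : Cell) : Op L :=
  opZ (Finset.univ.filter fun e => cellDim e.1 = 1 ∧ Inside e.1 f)

/-- The Hamiltonian of the cubic RBH model: the cluster terms of the bulk and of the primal, dual
and sink facets (all qubits off the toric code facet), and the dressed toric code. -/
def hamiltonian (L : Dims) : Op L :=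
  -(∑ i ∈ Finset.univ.filter (fun i : Qubit L => 0 < i.1.1), clusterTerm i)
    - ∑ v ∈ (vertices L).filter (fun v => v.1 = 0), starTerm L v
    - ∑ f ∈ (faces L).filter (fun f => f.1 = 0), plaquetteTerm L f

/-- The 1-form symmetry generator `S_v = ∏_{e ∋ v} X_e`. -/
def symV (L : Dims) (v : Cell) : Op L :=
  opX (Finset.univ.filter fun e => cellDim e.1 = 1 ∧ Inside v e.1)

/-- The 1-form symmetry generator `S_q = ∏_{f ⊂ q} X_f`. -/
def symQ (L : Dims) (q : Cell) : Op L :=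
  opX (Finset.univ.filter fun f => cellDim f.1 = 2 ∧ Inside f.1 q)

/-- The 1-form symmetry group `G = ⟨S_v, S_q⟩`. The generators are involutions, so the monoid that
they generate is a group. -/
def symGroup (L : Dims) : Submonoid (Op L) :=
  Submonoid.closure (symV L '' (vertices L : Set Cell) ∪ symQ L '' (cubes L : Set Cell))

/-! ### Energies and the symmetric energy barrier -/

/-- The smallest eigenvalue `E₀`. -/
def groundEnergy {L : Dims} (H : Op L) : ℝ :=
  sInf {E : ℝ | H.HasEigenvalue (E : ℂ)}

/-- The ground space. -/
def groundSpace {L : Dims} (H : Op L) : Submodule ℂ (QState L) :=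
  H.eigenspace (groundEnergy H : ℂ)

/-- The energy gap: the smallest excitation energy. -/
def energyGap {L : Dims} (H : Op L) : ℝ :=
  sInf {E : ℝ | H.HasEigenvalue (E : ℂ) ∧ groundEnergy H < E} - groundEnergy H

/-- `P` maps every ground state of `H` to an eigenstate of energy `E`. -/
def HasEnergy {L : Dims} (H P : Op L) (E : ℝ) : Prop :=
  ∀ ψ ∈ groundSpace H, ψ ≠ 0 → H.HasEigenvector (E : ℂ) (P ψ)

/-- A (nontrivial) Pauli logical operator: it preserves the ground space and does not act on it as
a scalar. -/
def IsLogical {L : Dims} (H P : Op L) : Prop :=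
  IsPauli P ∧ (∀ ψ ∈ groundSpace H, P ψ ∈ groundSpace H) ∧
    ¬ ∃ c : ℂ, ∀ ψ ∈ groundSpace H, P ψ = c • ψ

/-- `p 0, …, p N` is a local decomposition of `l`, with steps of range at most `r`, that is
symmetric under `G`. -/
structure IsSymLocalDecomp {L : Dims} (G : Submonoid (Op L)) (r : ℕ) (l : Op L) {N : ℕ}
    (p : Fin (N + 1) → Op L) : Prop where
  pauli : ∀ k, IsPauli (p k)
  first : p 0 = 1
  last : p (Fin.last N) = l
  step : ∀ k : Fin N, ∃ P : Op L, IsLocalPauli r P ∧ p k.succ = P * p k.castSucc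
  symmetric : ∀ k, ∀ g ∈ G, Commute (p k) g

/-- The energy barrier `max_k (E^(k) - E₀)` of a sequence of operators, where `E^(k)` is the energy
of `p k ψ₀` for any ground state `ψ₀`. -/
def decompBarrier {L : Dims} (H : Op L) {N : ℕ} (p : Fin (N + 1) → Op L) : EReal :=
  ⨆ (k : Fin (N + 1)) (E : ℝ) (_ : HasEnergy H (p k) E), ((E - groundEnergy H : ℝ) : EReal)

/-- The symmetric energy barrier for a logical fault: the smallest barrier of any symmetric local
decomposition (with steps of range at most `r`) of any logical operator. -/
def symEnergyBarrier {L : Dims} (H : Op L) (G : Submonoid (Op L)) (r : ℕ) : EReal :=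
  ⨅ (l : Op L) (_ : IsLogical H l) (N : ℕ) (p : Fin (N + 1) → Op L)
    (_ : IsSymLocalDecomp G r l p), decompBarrier H p

/-! ### The lattice width -/

/-- The smallest length of a walk from `A` to `B`. -/
def walkDist (Γ : SimpleGraph Cell) (A B : Set Cell) : ℕ :=
  sInf {n | ∃ u ∈ A, ∃ v ∈ B, ∃ w : Γ.Walk u v, w.length = n}

/-- The graph formed by the edges of the lattice, including the end points of the edges that
stick out at the dual and sink facets. -/
def latticeGraph (L : Dims) : SimpleGraph Cell :=
  SimpleGraph.fromRel fun u v =>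
    cellDim u = 0 ∧ cellDim v = 0 ∧ ∃ e ∈ edges L, Inside u e ∧ Inside v e

/-- The dual of the lattice of the toric code facet: two faces in the plane `x = 0` are joined when
they share an edge of the toric code facet; dual edges stick out at the two smooth edges. -/
def toricDualGraph (L : Dims) : SimpleGraph Cell :=
  SimpleGraph.fromRel fun f g =>
    (cellDim f = 2 ∧ f.1 = 0) ∧ (cellDim g = 2 ∧ g.1 = 0) ∧
      ∃ e ∈ edges L, e.1 = 0 ∧ Inside e f ∧ Inside e g

/-- The distance `d_Z` between the two rough edges of the toric code facet. -/
def dZ (L : Dims) : ℕ :=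
  walkDist (latticeGraph L) {v | cellDim v = 0 ∧ v.1 = 0 ∧ v.2.2 = 0}
    {v | cellDim v = 0 ∧ v.1 = 0 ∧ v.2.2 = 2 * L.z}

/-- The distance `d_X` between the two smooth edges of the toric code facet, on the dual lattice;
it counts the edges crossed. -/
def dX (L : Dims) : ℕ :=
  walkDist (toricDualGraph L) {f | cellDim f = 2 ∧ f.1 = 0 ∧ f.2.1 = -1}
    {f | cellDim f = 2 ∧ f.1 = 0 ∧ f.2.1 = 2 * L.y + 1}

/-- The distance `d_cond` between the toric code facet and the sink facet. -/
def dCond (L : Dims) : ℕ :=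
  walkDist (latticeGraph L) {v | cellDim v = 0 ∧ v.1 = 0} {v | cellDim v = 0 ∧ v.1 = 2 * L.x}

/-- The lattice width `d = min {d_Z, d_X, d_cond}`. -/
def latticeWidth (L : Dims) : ℕ := min (dZ L) (min (dX L) (dCond L))

end RBH

end

/-!
Every Pauli operator is a phase times `pauli p`, with `p` in a symplectic space over `𝔽₂`, and the
energy of `pauli p` on a ground state is twice the number of terms with which `p` anticommutes. The
violated cluster terms obey a conservation law: the symmetries make the syndrome of `p`
divergence-free at every vertex and every volume, so that excitations move along closed strings
which leave the lattice only through the rough edges, respectively the smooth edges, the toric code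
facet or the sink.

If `p` violates fewer cluster terms than the distance to the sink, some plane `x = const` is free of
violations. Below it, the flux of the syndrome through a plane `z = const` does not depend on the
plane, and if the latter plane is free of violations too, this flux is the parity with which `p`
crosses the toric code facet there; likewise for planes `y = const`. A local step with few
violations misses some violation-free plane, hence cannot change these parities. They vanish for the
identity, so they vanish at the end of a cheap symmetric decomposition, and an operator that
commutes with all terms and has even crossings is a product of terms, so it is not logical.
-/

noncomputable section

namespace RBH

open Finset

section PauliAlgebra

variable {ι : Type*}

/-- The sign `(-1) ^ x` of a bit `x`. -/
def sgn : AddChar (ZMod 2) ℂ := AddChar.zmodChar 2 neg_one_sq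

lemma sgn_one : sgn 1 = -1 := by simp [sgn, AddChar.zmodChar_apply, ZMod.val_one]

lemma sgn_apply (x : ZMod 2) : sgn x = if x = 0 then 1 else -1 := by
  split_ifs with h
  · rw [h, AddChar.map_zero_eq_one]
  · obtain rfl : x = 1 := Fin.eq_one_of_ne_zero x h
    exact sgn_one

lemma sgn_eq_one_iff {x : ZMod 2} : sgn x = 1 ↔ x = 0 := by
  rw [sgn_apply]
  split_ifs with h <;> norm_num [h]

lemma sgn_mul_self (x : ZMod 2) : sgn x * sgn x = 1 := by
  rw [← AddChar.map_add_eq_mul, CharTwo.add_self_eq_zero, AddChar.map_zero_eq_one]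

lemma sgn_sum (s : Finset ι) (f : ι → ZMod 2) : sgn (∑ i ∈ s, f i) = ∏ i ∈ s, sgn (f i) :=
  map_prod sgn.toMonoidHom (fun i => Multiplicative.ofAdd (f i)) s

/-- The `X` part and the `Z` part of a Pauli operator on the qubits `ι`, considered up to a
phase. -/
abbrev PauliVec (ι : Type*) := (ι → ZMod 2) × (ι → ZMod 2)

/-- The indicator vector of a set of qubits. -/
def ind [DecidableEq ι] (S : Finset ι) : ι → ZMod 2 := fun i => if i ∈ S then 1 else 0

lemma ind_empty [DecidableEq ι] : ind (∅ : Finset ι) = 0 := by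
  funext i; simp [ind]

lemma ind_eq_sum [DecidableEq ι] (S : Finset ι) : ind S = ∑ i ∈ S, Pi.single i 1 := by
  funext j; simp [ind, Finset.sum_apply, Pi.single_apply]

variable [Fintype ι]

lemma dotProduct_ind [DecidableEq ι] (a : ι → ZMod 2) (S : Finset ι) :
    a ⬝ᵥ ind S = ∑ i ∈ S, a i := by
  simp only [dotProduct, ind, mul_ite, mul_one, mul_zero, sum_ite_mem, univ_inter]

/-- The Pauli operator `X ^ p.1 * Z ^ p.2` on the space of amplitudes in the computational
basis. -/
def pauli (p : PauliVec ι) : Module.End ℂ ((ι → ZMod 2) → ℂ) where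
  toFun ψ := fun s => sgn (p.2 ⬝ᵥ (s + p.1)) * ψ (s + p.1)
  map_add' _ _ := by funext s; simp [mul_add]
  map_smul' _ _ := by funext s; simp [mul_left_comm]

lemma pauli_apply (p : PauliVec ι) (ψ : (ι → ZMod 2) → ℂ) (s : ι → ZMod 2) :
    pauli p ψ s = sgn (p.2 ⬝ᵥ (s + p.1)) * ψ (s + p.1) := rfl

/-- The symplectic form on Pauli vectors: two Pauli operators commute if it vanishes, and
anticommute otherwise. -/
def commForm : LinearMap.BilinForm (ZMod 2) (PauliVec ι) :=
  (dotProductBilin (ZMod 2) (ZMod 2)).compl₁₂ (.fst _ _ _) (.snd _ _ _) +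
    (dotProductBilin (ZMod 2) (ZMod 2)).compl₁₂ (.snd _ _ _) (.fst _ _ _)

lemma commForm_apply (p q : PauliVec ι) : commForm p q = p.1 ⬝ᵥ q.2 + p.2 ⬝ᵥ q.1 := rfl

lemma commForm_comm (p q : PauliVec ι) : commForm p q = commForm q p := by
  simp only [commForm_apply, dotProduct_comm q.1, dotProduct_comm q.2, add_comm]

lemma commForm_eq_zero_of_mem_span {s : Set (PauliVec ι)} {p q : PauliVec ι}
    (h : ∀ q ∈ s, commForm p q = 0) (hq : q ∈ Submodule.span (ZMod 2) s) : commForm p q = 0 :=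
  (Submodule.span_le (p := LinearMap.ker (commForm p))).2 h hq

lemma pauli_mul (p q : PauliVec ι) :
    pauli p * pauli q = sgn (p.2 ⬝ᵥ q.1) • pauli (p + q) := by
  refine LinearMap.ext fun ψ => funext fun s => ?_
  simp only [Module.End.mul_apply, LinearMap.smul_apply, Pi.smul_apply, smul_eq_mul, pauli_apply,
    Prod.fst_add, Prod.snd_add, ← mul_assoc, ← AddChar.map_add_eq_mul, add_assoc]
  congr 2
  simp only [add_dotProduct, dotProduct_add]
  linear_combination -CharTwo.add_self_eq_zero (p.2 ⬝ᵥ q.1)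

lemma pauli_zero : pauli (0 : PauliVec ι) = 1 := by
  refine LinearMap.ext fun ψ => funext fun s => ?_
  simp [pauli_apply]

lemma pauli_mul_comm (p q : PauliVec ι) :
    pauli p * pauli q = sgn (commForm p q) • (pauli q * pauli p) := by
  rw [pauli_mul, pauli_mul, smul_smul, add_comm q p, commForm_apply, AddChar.map_add_eq_mul,
    dotProduct_comm p.1, mul_right_comm, sgn_mul_self, one_mul]

lemma pauli_mul_self (p : PauliVec ι) : pauli p * pauli p = sgn (p.2 ⬝ᵥ p.1) • 1 := by
  rw [pauli_mul, ZModModule.add_self, pauli_zero]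

lemma pauli_injective (p : PauliVec ι) : Function.Injective (pauli p) := fun ψ φ h =>
  smul_right_injective _ (sgn.val_isUnit _).ne_zero <| by
    simpa only [← Module.End.mul_apply, pauli_mul_self, LinearMap.smul_apply,
      Module.End.one_apply] using congrArg (pauli p) h

lemma commForm_eq_zero_of_commute {c : ℂ} (hc : c ≠ 0) {p q : PauliVec ι}
    (h : Commute (c • pauli p) (pauli q)) : commForm p q = 0 := by
  have hqp : pauli q * pauli p ≠ 0 := fun h0 => by
    have h1 := LinearMap.congr_fun h0 1
    rw [Module.End.mul_apply, LinearMap.zero_apply] at h1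
    exact one_ne_zero (pauli_injective p ((pauli_injective q (h1.trans (map_zero _).symm)).trans
      (map_zero _).symm))
  have hcomm : sgn (commForm p q) • (pauli q * pauli p) = (1 : ℂ) • (pauli q * pauli p) := by
    rw [← pauli_mul_comm, one_smul]
    refine smul_right_injective _ hc ?_
    simpa only [smul_mul_assoc, mul_smul_comm] using h.eq
  exact sgn_eq_one_iff.1 (smul_left_injective ℂ hqp hcomm)

end PauliAlgebra

section PauliOperators

variable {L : Dims}

lemma opX_mul_opZ (B C : Finset (Qubit L)) : opX B * opZ C = pauli (ind B, ind C) := by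
  refine LinearMap.ext fun ψ => funext fun s => ?_
  have hs : (fun i => if i ∈ B then s i + 1 else s i) = s + ind B := by
    funext i; by_cases h : i ∈ B <;> simp [ind, h]
  simp only [Module.End.mul_apply, opX, opZ, LinearMap.coe_mk, AddHom.coe_mk, pauli_apply, hs,
    dotProduct_comm (ind C), dotProduct_ind, sgn_sum]
  simp only [sgn_apply, ← hs]

lemma opX_empty : opX (∅ : Finset (Qubit L)) = 1 := by
  refine LinearMap.ext fun ψ => funext fun s => ?_; simp [opX]

lemma opZ_empty : opZ (∅ : Finset (Qubit L)) = 1 := by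
  refine LinearMap.ext fun ψ => funext fun s => ?_; simp [opZ]

lemma opX_eq_pauli (B : Finset (Qubit L)) : opX B = pauli (ind B, 0) := by
  rw [← ind_empty, ← opX_mul_opZ, opZ_empty, mul_one]

lemma opZ_eq_pauli (C : Finset (Qubit L)) : opZ C = pauli (0, ind C) := by
  rw [← ind_empty, ← opX_mul_opZ, opX_empty, one_mul]

lemma IsPauliOn.exists_eq_smul_pauli {A : Finset (Qubit L)} {P : Op L} (h : IsPauliOn A P) :
    ∃ (c : ℂ) (p : PauliVec (Qubit L)), c ≠ 0 ∧ P = c • pauli p ∧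
      ∀ i ∉ A, p.1 i = 0 ∧ p.2 i = 0 := by
  obtain ⟨c, B, C, hc, hB, hC, rfl⟩ := h
  refine ⟨c, (ind B, ind C), ?_, by rw [opX_mul_opZ], fun i hi => ⟨?_, ?_⟩⟩
  · rintro rfl; norm_num at hc
  · exact if_neg fun h => hi (hB h)
  · exact if_neg fun h => hi (hC h)

end PauliOperators

section CommutingInvolutions

variable {V J : Type*} [AddCommGroup V] [Module ℂ V]

/-- The vectors on which every operator `T j` acts as the sign `sgn (σ j)`. -/
def jointEigenspace (T : J → Module.End ℂ V) (σ : J → ZMod 2) : Submodule ℂ V :=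
  ⨅ j, (T j).eigenspace (sgn (σ j))

variable {T : J → Module.End ℂ V}

lemma mem_jointEigenspace {σ : J → ZMod 2} {ψ : V} :
    ψ ∈ jointEigenspace T σ ↔ ∀ j, T j ψ = sgn (σ j) • ψ := by
  simp only [jointEigenspace, Submodule.mem_iInf, Module.End.mem_eigenspace_iff]

lemma mem_jointEigenspace_zero {ψ : V} : ψ ∈ jointEigenspace T 0 ↔ ∀ j, T j ψ = ψ := by
  simp only [mem_jointEigenspace, Pi.zero_apply, AddChar.map_zero_eq_one, one_smul]

lemma eigenspace_mem_invtSubmodule_of_commute {S T : Module.End ℂ V} (h : Commute S T) (μ : ℂ) :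
    S.eigenspace μ ∈ T.invtSubmodule :=
  Module.End.mapsTo_genEigenspace_of_comm h μ 1

lemma exists_inf_eigenspace_ne_bot {T : Module.End ℂ V} (hT : T * T = 1) {S : Submodule ℂ V}
    (hS : S ∈ T.invtSubmodule) (hne : S ≠ ⊥) : ∃ ε, S ⊓ T.eigenspace (sgn ε) ≠ ⊥ := by
  obtain ⟨φ, hφ, h0⟩ := S.ne_bot_iff.1 hne
  have hmem (ε : ZMod 2) : φ + sgn ε • T φ ∈ S ⊓ T.eigenspace (sgn ε) := by
    refine ⟨S.add_mem hφ (S.smul_mem _ (hS hφ)), Module.End.mem_eigenspace_iff.2 ?_⟩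
    rw [map_add, map_smul, ← Module.End.mul_apply, hT, Module.End.one_apply, smul_add, smul_smul,
      sgn_mul_self, one_smul, add_comm]
  by_contra! hbot
  have hzero (ε : ZMod 2) : φ + sgn ε • T φ = 0 := (Submodule.mem_bot ℂ).1 (hbot ε ▸ hmem ε)
  refine h0 ((smul_eq_zero.1 ?_).resolve_left (two_ne_zero (α := ℂ)))
  calc (2 : ℂ) • φ = (φ + sgn 0 • T φ) + (φ + sgn 1 • T φ) := by
        rw [AddChar.map_zero_eq_one, sgn_one]; module
    _ = 0 := by rw [hzero, hzero, add_zero]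

lemma exists_inf_jointEigenspace_ne_bot [Finite J] (hT : ∀ i j, Commute (T i) (T j))
    (hT2 : ∀ i, T i * T i = 1) {S : Submodule ℂ V} (hS : ∀ i, S ∈ (T i).invtSubmodule)
    (hne : S ≠ ⊥) : ∃ σ, S ⊓ jointEigenspace T σ ≠ ⊥ := by
  classical
  cases nonempty_fintype J
  suffices h : ∀ s : Finset J, ∃ σ : J → ZMod 2,
      S ⊓ ⨅ j ∈ s, (T j).eigenspace (sgn (σ j)) ≠ ⊥ by
    simpa only [mem_univ, iInf_pos, jointEigenspace] using h univ
  intro s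
  induction s using Finset.induction_on generalizing S with
  | empty => exact ⟨0, by simpa using hne⟩
  | insert i s hi ih =>
    obtain ⟨ε, hε⟩ := exists_inf_eigenspace_ne_bot (hT2 i) (hS i) hne
    obtain ⟨σ, hσ⟩ := ih (fun j => Module.End.invtSubmodule.inf_mem (hS j)
      (eigenspace_mem_invtSubmodule_of_commute (hT i j) _)) hε
    refine ⟨Function.update σ i ε, ?_⟩
    have hs : ⨅ j ∈ s, (T j).eigenspace (sgn (Function.update σ i ε j)) =
        ⨅ j ∈ s, (T j).eigenspace (sgn (σ j)) :=
      biInf_congr fun j hj => by rw [Function.update_of_ne (ne_of_mem_of_not_mem hj hi)]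
    rwa [Finset.iInf_insert, Function.update_self, hs, ← inf_assoc]

variable [Fintype J]

lemma neg_sum_apply_of_mem_jointEigenspace {σ : J → ZMod 2} {ψ : V}
    (h : ψ ∈ jointEigenspace T σ) :
    (-∑ j, T j) ψ = ((-Fintype.card J + 2 * hammingNorm σ : ℝ) : ℂ) • ψ := by
  have hsgn : ∑ j, sgn (σ j) = Fintype.card J - 2 * hammingNorm σ := by
    calc ∑ j, sgn (σ j) = ∑ j, (1 - 2 * if σ j ≠ 0 then 1 else 0 : ℂ) :=
          sum_congr rfl fun j _ => by
            rw [sgn_apply, ite_not]; split_ifs <;> norm_num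
      _ = Fintype.card J - 2 * hammingNorm σ := by
          rw [sum_sub_distrib, ← mul_sum, sum_boole, sum_const, nsmul_one]; rfl
  rw [LinearMap.neg_apply, LinearMap.sum_apply, sum_congr rfl fun j _ => mem_jointEigenspace.1 h j,
    ← sum_smul, hsgn, ← neg_smul]
  congr 1
  push_cast
  ring

lemma exists_eq_of_inf_eigenspace_neg_sum_ne_bot (hT : ∀ i j, Commute (T i) (T j))
    (hT2 : ∀ i, T i * T i = 1) {S : Submodule ℂ V} (hS : ∀ i, S ∈ (T i).invtSubmodule) {E : ℝ}
    (hne : S ⊓ (-∑ j, T j).eigenspace (E : ℂ) ≠ ⊥) :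
    ∃ σ, E = -Fintype.card J + 2 * hammingNorm σ ∧ S ⊓ jointEigenspace T σ ≠ ⊥ := by
  have hcomm (i : J) : Commute (-∑ j, T j) (T i) :=
    (Commute.sum_left _ _ _ fun j _ => hT j i).neg_left
  obtain ⟨σ, hσ⟩ := exists_inf_jointEigenspace_ne_bot hT hT2 (fun i =>
    Module.End.invtSubmodule.inf_mem (hS i)
      (eigenspace_mem_invtSubmodule_of_commute (hcomm i) E)) hne
  obtain ⟨φ, ⟨⟨hφS, hφE⟩, hφσ⟩, h0⟩ := Submodule.ne_bot_iff _ |>.1 hσ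
  refine ⟨σ, ?_, (Submodule.ne_bot_iff _).2 ⟨φ, ⟨hφS, hφσ⟩, h0⟩⟩
  have h := Module.End.mem_eigenspace_iff.1 hφE
  rw [neg_sum_apply_of_mem_jointEigenspace hφσ] at h
  exact_mod_cast (smul_left_injective ℂ h0 h).symm

lemma eigenspace_neg_sum_eq_jointEigenspace_zero (hT : ∀ i j, Commute (T i) (T j))
    (hT2 : ∀ i, T i * T i = 1) :
    (-∑ j, T j).eigenspace ((-Fintype.card J : ℝ) : ℂ) = jointEigenspace T 0 := by
  refine le_antisymm (fun ψ hψ => mem_jointEigenspace_zero.2 fun t => ?_) fun ψ hψ => ?_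
  · by_contra hne
    have hcomm : Commute (T t) (-∑ j, T j) :=
      (Commute.sum_right _ _ _ fun j _ => hT t j).neg_right
    have hflip : ψ - T t ψ ∈ (T t).eigenspace (-1) := by
      rw [Module.End.mem_eigenspace_iff, map_sub, ← Module.End.mul_apply, hT2,
        Module.End.one_apply, neg_one_smul, neg_sub]
    have hlow : ψ - T t ψ ∈ (-∑ j, T j).eigenspace ((-Fintype.card J : ℝ) : ℂ) :=
      Submodule.sub_mem _ hψ (eigenspace_mem_invtSubmodule_of_commute hcomm.symm _ hψ)
    obtain ⟨σ, hσ, hne'⟩ := exists_eq_of_inf_eigenspace_neg_sum_ne_bot hT hT2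
      (fun i => eigenspace_mem_invtSubmodule_of_commute (hT t i) (-1))
      ((Submodule.ne_bot_iff _).2 ⟨_, ⟨hflip, hlow⟩, fun h => hne (sub_eq_zero.1 h).symm⟩)
    have hσ0 : σ = 0 := hammingNorm_eq_zero.1 (by exact_mod_cast (by linarith :
      (hammingNorm σ : ℝ) = 0))
    obtain ⟨φ, ⟨hφt, hφσ⟩, hφ0⟩ := (Submodule.ne_bot_iff _).1 hne'
    have hfix := mem_jointEigenspace_zero.1 (hσ0 ▸ hφσ) t
    rw [Module.End.mem_eigenspace_iff.1 hφt] at hfix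
    exact absurd (smul_left_injective ℂ hφ0 (hfix.trans (one_smul ℂ φ).symm)) (by norm_num)
  · simpa using neg_sum_apply_of_mem_jointEigenspace hψ

end CommutingInvolutions

section StabilizerFamily

variable {ι J : Type*} [Fintype ι]

/-- The joint `+1` eigenspace of the Pauli operators `pauli (g j)`. -/
def codeSpace (g : J → PauliVec ι) : Submodule ℂ ((ι → ZMod 2) → ℂ) :=
  jointEigenspace (fun j => pauli (g j)) 0

/-- Commuting, self-inverse Pauli operators with a joint fixed vector, so that minus their sum is a
frustration-free Hamiltonian. -/
structure IsStabilizerFamily (g : J → PauliVec ι) : Prop where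
  commForm_eq_zero : ∀ i j, commForm (g i) (g j) = 0
  dotProduct_eq_zero : ∀ j, (g j).2 ⬝ᵥ (g j).1 = 0
  codeSpace_ne_bot : codeSpace g ≠ ⊥

variable {g : J → PauliVec ι}

lemma mem_codeSpace {ψ : (ι → ZMod 2) → ℂ} : ψ ∈ codeSpace g ↔ ∀ j, pauli (g j) ψ = ψ :=
  mem_jointEigenspace_zero

lemma commute_pauli {p q : PauliVec ι} (h : commForm p q = 0) : Commute (pauli p) (pauli q) := by
  rw [Commute, SemiconjBy, pauli_mul_comm, h, AddChar.map_zero_eq_one, one_smul]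

lemma pauli_mul_self_eq_one {p : PauliVec ι} (h : p.2 ⬝ᵥ p.1 = 0) : pauli p * pauli p = 1 := by
  rw [pauli_mul_self, h, AddChar.map_zero_eq_one, one_smul]

lemma pauli_apply_mem_jointEigenspace (p : PauliVec ι) {σ : J → ZMod 2} {ψ : (ι → ZMod 2) → ℂ}
    (hψ : ψ ∈ jointEigenspace (fun j => pauli (g j)) σ) :
    pauli p ψ ∈ jointEigenspace (fun j => pauli (g j)) (σ + fun j => commForm p (g j)) := by
  refine mem_jointEigenspace.2 fun j => ?_
  rw [← Module.End.mul_apply, pauli_mul_comm, LinearMap.smul_apply, Module.End.mul_apply,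
    mem_jointEigenspace.1 hψ, map_smul, smul_smul, ← AddChar.map_add_eq_mul, commForm_comm,
    add_comm, Pi.add_apply]

lemma pauli_single_zero {p : PauliVec ι} (h : p.1 = 0) :
    pauli p (Pi.single 0 1) = Pi.single 0 1 := by
  funext s
  rw [pauli_apply, h, add_zero]
  by_cases hs : s = 0
  · rw [hs, dotProduct_zero, AddChar.map_zero_eq_one, one_mul]
  · rw [Pi.single_eq_of_ne hs, mul_zero]

lemma IsStabilizerFamily.commute (hg : IsStabilizerFamily g) (i j : J) :
    Commute (pauli (g i)) (pauli (g j)) := commute_pauli (hg.commForm_eq_zero i j)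

lemma IsStabilizerFamily.mul_self (hg : IsStabilizerFamily g) (j : J) :
    pauli (g j) * pauli (g j) = 1 :=
  pauli_mul_self_eq_one (hg.dotProduct_eq_zero j)

lemma exists_commForm_eq [Finite J] [DecidableEq J]
    (hdual : ∀ j, (g j).1 ≠ 0 → ∃ p, (fun i => commForm p (g i)) = Pi.single j 1)
    {σ : J → ZMod 2} (hσ : ∀ j, (g j).1 = 0 → σ j = 0) :
    ∃ p, (fun j => commForm p (g j)) = σ := by
  cases nonempty_fintype J
  have hsingle (j : J) : ∃ p, (fun i => commForm p (g i)) = Pi.single j (σ j) := by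
    by_cases hj : (g j).1 = 0
    · exact ⟨0, by simp only [map_zero, LinearMap.zero_apply, hσ j hj, Pi.single_zero]; rfl⟩
    · obtain ⟨p, hp⟩ := hdual j hj
      refine ⟨σ j • p, ?_⟩
      simp only [map_smul, LinearMap.smul_apply]
      rw [← Pi.smul_def, hp, ← Pi.single_smul, smul_eq_mul, mul_one]
  choose p hp using hsingle
  refine ⟨∑ j, p j, funext fun i => ?_⟩
  rw [map_sum, LinearMap.sum_apply, sum_congr rfl fun j _ => congrFun (hp j) i,
    ← Finset.sum_apply, Finset.univ_sum_single]

/-- The basis state `0` is fixed by the `Z`-type generators, and the signs that the other ones take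
on a joint eigenvector in the space so fixed are corrected by a Pauli operator. -/
lemma codeSpace_ne_bot_of_exists_dual [Finite J] [DecidableEq J]
    (hcomm : ∀ i j, commForm (g i) (g j) = 0) (hsq : ∀ j, (g j).2 ⬝ᵥ (g j).1 = 0)
    (hdual : ∀ j, (g j).1 ≠ 0 → ∃ p, (fun i => commForm p (g i)) = Pi.single j 1) :
    codeSpace g ≠ ⊥ := by
  set S : Submodule ℂ ((ι → ZMod 2) → ℂ) := codeSpace fun j : {j // (g j).1 = 0} => g j
  have hne : S ≠ ⊥ := (Submodule.ne_bot_iff _).2 ⟨Pi.single 0 1,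
    mem_codeSpace.2 fun j => pauli_single_zero j.2, by simp⟩
  have hinv (i : J) : S ∈ (pauli (g i)).invtSubmodule := fun ψ hψ => by
    have h := pauli_apply_mem_jointEigenspace (g i) hψ
    simp only [hcomm, ← Pi.zero_def, add_zero] at h
    exact h
  obtain ⟨σ, hσ⟩ := exists_inf_jointEigenspace_ne_bot
    (fun i j => commute_pauli (hcomm i j)) (fun i => pauli_mul_self_eq_one (hsq i)) hinv hne
  obtain ⟨φ, ⟨hφS, hφσ⟩, h0⟩ := (Submodule.ne_bot_iff _).1 hσ
  obtain ⟨p, hp⟩ := exists_commForm_eq hdual (σ := σ) fun j hj =>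
    sgn_eq_one_iff.1 <| smul_left_injective ℂ h0 <| by
      simp only [← mem_jointEigenspace.1 hφσ j, mem_codeSpace.1 hφS ⟨j, hj⟩, one_smul]
  refine (Submodule.ne_bot_iff _).2 ⟨pauli p φ, ?_, fun h =>
    h0 (pauli_injective p (h.trans (map_zero _).symm))⟩
  have h := pauli_apply_mem_jointEigenspace p hφσ
  rwa [hp, ZModModule.add_self] at h

lemma exists_smul_of_mem_span {p : PauliVec ι}
    (hp : p ∈ Submodule.span (ZMod 2) (Set.range g)) :
    ∃ c : ℂ, ∀ ψ ∈ codeSpace g, pauli p ψ = c • ψ := by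
  induction hp using Submodule.span_induction with
  | mem _ h =>
    obtain ⟨j, rfl⟩ := h
    exact ⟨1, fun ψ hψ => by rw [mem_codeSpace.1 hψ, one_smul]⟩
  | zero => exact ⟨1, fun ψ _ => by rw [pauli_zero, Module.End.one_apply, one_smul]⟩
  | add p q _ _ hp hq =>
    obtain ⟨c, hc⟩ := hp
    obtain ⟨d, hd⟩ := hq
    have hadd : pauli (p + q) = sgn (p.2 ⬝ᵥ q.1) • (pauli p * pauli q) := by
      rw [pauli_mul, smul_smul, sgn_mul_self, one_smul]
    refine ⟨sgn (p.2 ⬝ᵥ q.1) * (d * c), fun ψ hψ => ?_⟩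
    rw [hadd, LinearMap.smul_apply, Module.End.mul_apply, hd ψ hψ, map_smul, hc ψ hψ, smul_smul,
      smul_smul, mul_assoc]
  | smul x p _ hp =>
    obtain rfl | rfl : x = 0 ∨ x = 1 := by revert x; decide
    · exact ⟨1, fun ψ _ => by rw [zero_smul, pauli_zero, Module.End.one_apply, one_smul]⟩
    · rwa [one_smul]

end StabilizerFamily

section StabilizerHamiltonian

variable {L : Dims} {J : Type*} [Fintype J]

/-- The Hamiltonian `-∑ j, pauli (g j)`. -/
def stabilizerHamiltonian (g : J → PauliVec (Qubit L)) : Op L := -∑ j, pauli (g j)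

namespace IsStabilizerFamily

variable {g : J → PauliVec (Qubit L)}

lemma exists_energy_eq (hg : IsStabilizerFamily g) {E : ℝ}
    (hE : (stabilizerHamiltonian g).HasEigenvalue (E : ℂ)) :
    ∃ n : ℕ, E = -Fintype.card J + 2 * n := by
  obtain ⟨σ, hσ, -⟩ := exists_eq_of_inf_eigenspace_neg_sum_ne_bot hg.commute hg.mul_self
    (S := ⊤) (fun _ => Module.End.invtSubmodule.top_mem _) (by rwa [top_inf_eq])
  exact ⟨_, hσ⟩

lemma hasEigenvector_smul_pauli {c : ℂ} (hc : c ≠ 0) (p : PauliVec (Qubit L)) {ψ : QState L}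
    (hψ : ψ ∈ codeSpace g) (h0 : ψ ≠ 0) :
    (stabilizerHamiltonian g).HasEigenvector
      ((-Fintype.card J + 2 * hammingNorm (fun j => commForm p (g j)) : ℝ) : ℂ)
      ((c • pauli p) ψ) := by
  have h := pauli_apply_mem_jointEigenspace p hψ
  rw [zero_add] at h
  refine ⟨Module.End.mem_eigenspace_iff.2 ?_,
    smul_ne_zero hc fun h => h0 (pauli_injective p (h.trans (map_zero _).symm))⟩
  exact neg_sum_apply_of_mem_jointEigenspace (Submodule.smul_mem _ c h)

lemma groundEnergy_eq (hg : IsStabilizerFamily g) :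
    groundEnergy (stabilizerHamiltonian g) = -Fintype.card J := by
  refine IsLeast.csInf_eq ⟨?_, fun E hE => ?_⟩
  · obtain ⟨ψ, hψ, h0⟩ := (Submodule.ne_bot_iff _).1 hg.codeSpace_ne_bot
    have h := hasEigenvector_smul_pauli one_ne_zero 0 hψ h0
    simp only [map_zero, LinearMap.zero_apply, ← Pi.zero_def, hammingNorm_zero, Nat.cast_zero,
      mul_zero, add_zero] at h
    exact Module.End.hasEigenvalue_of_hasEigenvector h
  · obtain ⟨n, rfl⟩ := hg.exists_energy_eq hE
    linarith [n.cast_nonneg (α := ℝ)]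

lemma groundSpace_eq (hg : IsStabilizerFamily g) :
    groundSpace (stabilizerHamiltonian g) = codeSpace g := by
  rw [groundSpace, hg.groundEnergy_eq]
  exact eigenspace_neg_sum_eq_jointEigenspace_zero hg.commute hg.mul_self

lemma hasEnergy_smul_pauli (hg : IsStabilizerFamily g) {c : ℂ} (hc : c ≠ 0)
    (p : PauliVec (Qubit L)) :
    HasEnergy (stabilizerHamiltonian g) (c • pauli p)
      (-Fintype.card J + 2 * hammingNorm (fun j => commForm p (g j))) :=
  fun _ hψ h0 => hasEigenvector_smul_pauli hc p (hg.groundSpace_eq ▸ hψ) h0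

lemma energyGap_eq (hg : IsStabilizerFamily g)
    (h : ∃ p, hammingNorm (fun j => commForm p (g j)) = 1) :
    energyGap (stabilizerHamiltonian g) = 2 := by
  obtain ⟨p, hp⟩ := h
  rw [energyGap, hg.groundEnergy_eq, sub_eq_iff_eq_add']
  refine IsLeast.csInf_eq ⟨⟨?_, by linarith⟩, fun E hE => ?_⟩
  · obtain ⟨ψ, hψ, h0⟩ := (Submodule.ne_bot_iff _).1 hg.codeSpace_ne_bot
    have h := hasEigenvector_smul_pauli one_ne_zero p hψ h0
    rw [hp, Nat.cast_one, mul_one] at h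
    exact Module.End.hasEigenvalue_of_hasEigenvector h
  · obtain ⟨n, rfl⟩ := hg.exists_energy_eq hE.1
    have hpos : (0 : ℝ) < n := by linarith [hE.2]
    have hone : (1 : ℝ) ≤ n := by exact_mod_cast hpos
    linarith

lemma commForm_eq_zero_of_preserves (hg : IsStabilizerFamily g) {c : ℂ} (hc : c ≠ 0)
    {p : PauliVec (Qubit L)}
    (h : ∀ ψ ∈ groundSpace (stabilizerHamiltonian g),
      (c • pauli p) ψ ∈ groundSpace (stabilizerHamiltonian g)) (j : J) :
    commForm p (g j) = 0 := by
  obtain ⟨ψ, hψ, h0⟩ := (Submodule.ne_bot_iff _).1 hg.codeSpace_ne_bot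
  have hsgn := mem_jointEigenspace.1 (pauli_apply_mem_jointEigenspace p hψ) j
  rw [hg.groundSpace_eq] at h
  have hfix := mem_codeSpace.1 ((Submodule.smul_mem_iff _ hc).1 (h ψ hψ)) j
  have hne : pauli p ψ ≠ 0 := fun h => h0 (pauli_injective p (h.trans (map_zero _).symm))
  rw [zero_add] at hsgn
  refine sgn_eq_one_iff.1 (smul_left_injective ℂ hne ?_)
  simp only [← hsgn, hfix, one_smul]

lemma exists_smul_of_mem_span (hg : IsStabilizerFamily g) {p : PauliVec (Qubit L)}
    (hp : p ∈ Submodule.span (ZMod 2) (Set.range g)) (c : ℂ) :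
    ∃ d : ℂ, ∀ ψ ∈ groundSpace (stabilizerHamiltonian g), (c • pauli p) ψ = d • ψ := by
  obtain ⟨d, hd⟩ := RBH.exists_smul_of_mem_span hp
  exact ⟨c * d, fun ψ hψ => by
    rw [LinearMap.smul_apply, hd ψ (hg.groundSpace_eq ▸ hψ), smul_smul]⟩

end IsStabilizerFamily

end StabilizerHamiltonian

section Cells

variable {L : Dims}

lemma mem_box {x y z : ℤ} : (x, y, z) ∈ box L ↔
    (0 ≤ x ∧ x ≤ 2 * L.x) ∧ (0 ≤ y ∧ y ≤ 2 * L.y) ∧ 1 ≤ z ∧ z ≤ 2 * L.z - 1 := by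
  simp only [box, mem_product, mem_Icc]

lemma mem_qubitSites {x y z : ℤ} : (x, y, z) ∈ qubitSites L ↔
    ((0 ≤ x ∧ x ≤ 2 * L.x) ∧ (0 ≤ y ∧ y ≤ 2 * L.y) ∧ 1 ≤ z ∧ z ≤ 2 * L.z - 1) ∧
      (x % 2 + y % 2 + z % 2 = 1 ∧ x < 2 * L.x ∨ x % 2 + y % 2 + z % 2 = 2 ∧ 0 < x) := by
  simp only [qubitSites, edges, faces, mem_union, mem_filter, mem_box]
  tauto

lemma mem_vertices {x y z : ℤ} : (x, y, z) ∈ vertices L ↔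
    ((0 ≤ x ∧ x ≤ 2 * L.x) ∧ (0 ≤ y ∧ y ≤ 2 * L.y) ∧ 1 ≤ z ∧ z ≤ 2 * L.z - 1) ∧
      x % 2 + y % 2 + z % 2 = 0 ∧ x < 2 * L.x := by
  simp only [vertices, mem_filter, mem_box]

lemma mem_edges {x y z : ℤ} : (x, y, z) ∈ edges L ↔
    ((0 ≤ x ∧ x ≤ 2 * L.x) ∧ (0 ≤ y ∧ y ≤ 2 * L.y) ∧ 1 ≤ z ∧ z ≤ 2 * L.z - 1) ∧
      x % 2 + y % 2 + z % 2 = 1 ∧ x < 2 * L.x := by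
  simp only [edges, mem_filter, mem_box]

lemma mem_faces {x y z : ℤ} : (x, y, z) ∈ faces L ↔
    ((0 ≤ x ∧ x ≤ 2 * L.x) ∧ (0 ≤ y ∧ y ≤ 2 * L.y) ∧ 1 ≤ z ∧ z ≤ 2 * L.z - 1) ∧
      x % 2 + y % 2 + z % 2 = 2 := by
  simp only [faces, mem_filter, mem_box]

lemma mem_cubes {x y z : ℤ} : (x, y, z) ∈ cubes L ↔
    ((0 ≤ x ∧ x ≤ 2 * L.x) ∧ (0 ≤ y ∧ y ≤ 2 * L.y) ∧ 1 ≤ z ∧ z ≤ 2 * L.z - 1) ∧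
      x % 2 + y % 2 + z % 2 = 3 := by
  simp only [cubes, mem_filter, mem_box]

lemma inside_iff {x y z x' y' z' : ℤ} : Inside (x, y, z) (x', y', z') ↔
    (x = x' ∨ x' % 2 = 1 ∧ (x = x' + 1 ∨ x = x' - 1)) ∧
    (y = y' ∨ y' % 2 = 1 ∧ (y = y' + 1 ∨ y = y' - 1)) ∧
    (z = z' ∨ z' % 2 = 1 ∧ (z = z' + 1 ∨ z = z' - 1)) := by
  have h (a b : ℤ) : (a = b ∨ (Odd b ∧ |a - b| = 1)) ↔
      (a = b ∨ b % 2 = 1 ∧ (a = b + 1 ∨ a = b - 1)) := by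
    rw [Int.odd_iff, abs_eq one_pos.le]; omega
  simp only [Inside, h]

/-- The six nearest neighbours of a cell in the lattice of doubled coordinates: the cells of one
dimension less that it contains, and the cells of one dimension more that contain it. -/
def neighbors (c : Cell) : Finset Cell :=
  {(c.1 + 1, c.2.1, c.2.2), (c.1 - 1, c.2.1, c.2.2), (c.1, c.2.1 + 1, c.2.2),
    (c.1, c.2.1 - 1, c.2.2), (c.1, c.2.1, c.2.2 + 1), (c.1, c.2.1, c.2.2 - 1)}

lemma mem_neighbors {x y z x' y' z' : ℤ} : (x', y', z') ∈ neighbors (x, y, z) ↔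
    ((x' = x + 1 ∨ x' = x - 1) ∧ y' = y ∧ z' = z) ∨ ((y' = y + 1 ∨ y' = y - 1) ∧ x' = x ∧ z' = z) ∨
      ((z' = z + 1 ∨ z' = z - 1) ∧ x' = x ∧ y' = y) := by
  simp only [neighbors, mem_insert, mem_singleton, Prod.mk.injEq]
  tauto

lemma mem_neighbors_comm {c d : Cell} : c ∈ neighbors d ↔ d ∈ neighbors c := by
  obtain ⟨x, y, z⟩ := c
  obtain ⟨x', y', z'⟩ := d
  rw [mem_neighbors, mem_neighbors]
  omega

lemma cellDim_of_mem_neighbors {c d : Cell} (h : c ∈ neighbors d) :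
    cellDim d = cellDim c + 1 ∨ cellDim c = cellDim d + 1 := by
  obtain ⟨x, y, z⟩ := c
  obtain ⟨x', y', z'⟩ := d
  rw [mem_neighbors] at h
  simp only [cellDim]
  omega

lemma inside_iff_mem_neighbors {c d : Cell} (h : cellDim d = cellDim c + 1) :
    Inside c d ↔ c ∈ neighbors d := by
  obtain ⟨x, y, z⟩ := c
  obtain ⟨x', y', z'⟩ := d
  rw [inside_iff, mem_neighbors]
  simp only [cellDim] at h
  constructor
  · rintro ⟨rfl | ⟨h1, rfl | rfl⟩, rfl | ⟨h2, rfl | rfl⟩, rfl | ⟨h3, rfl | rfl⟩⟩ <;> omega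
  · rintro (⟨rfl | rfl, rfl, rfl⟩ | ⟨rfl | rfl, rfl, rfl⟩ | ⟨rfl | rfl, rfl, rfl⟩) <;> omega

lemma eq_or_cellDim_lt_of_inside {c d : Cell} (h : Inside c d) : c = d ∨ cellDim c < cellDim d := by
  obtain ⟨x, y, z⟩ := c
  obtain ⟨x', y', z'⟩ := d
  rw [inside_iff] at h
  simp only [Prod.mk.injEq, cellDim]
  obtain ⟨rfl | ⟨h1, rfl | rfl⟩, rfl | ⟨h2, rfl | rfl⟩, rfl | ⟨h3, rfl | rfl⟩⟩ := h <;> omega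

lemma cellDim_qubit (i : Qubit L) : cellDim i.1 = 1 ∨ cellDim i.1 = 2 := by
  obtain ⟨⟨x, y, z⟩, hi⟩ := i
  have h := (mem_qubitSites.1 hi).2
  simp only [cellDim]
  omega

lemma cellDim_one_and_inside_iff {c : Cell} (hc : cellDim c = 0) (i : Qubit L) :
    (cellDim i.1 = 1 ∧ Inside c i.1) ↔ i.1 ∈ neighbors c := by
  rw [mem_neighbors_comm]
  refine ⟨fun h => (inside_iff_mem_neighbors (by omega)).1 h.2, fun h => ?_⟩
  have hi := cellDim_qubit i
  have hdim : cellDim i.1 = cellDim c + 1 := by have := cellDim_of_mem_neighbors h; omega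
  exact ⟨by omega, (inside_iff_mem_neighbors hdim).2 h⟩

lemma cellDim_and_inside_iff {n : ℤ} {c : Cell} (hc : cellDim c = n + 1) (hn : 1 ≤ n)
    (i : Qubit L) : (cellDim i.1 = n ∧ Inside i.1 c) ↔ i.1 ∈ neighbors c := by
  refine ⟨fun h => (inside_iff_mem_neighbors (by omega)).1 h.2, fun h => ?_⟩
  have hi := cellDim_qubit i
  have hdim : cellDim c = cellDim i.1 + 1 := by have := cellDim_of_mem_neighbors h; omega
  exact ⟨by omega, (inside_iff_mem_neighbors hdim).2 h⟩

lemma mem_nbrs {i j : Qubit L} : j ∈ nbrs i ↔ j.1 ∈ neighbors i.1 := by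
  have hi := cellDim_qubit i
  have hj := cellDim_qubit j
  simp only [nbrs, mem_filter, mem_univ, true_and, ne_eq, Subtype.ext_iff]
  constructor
  · rintro ⟨hne, h | h⟩
    · have hlt := (eq_or_cellDim_lt_of_inside h).resolve_left hne
      exact (inside_iff_mem_neighbors (by omega)).1 h
    · have hlt := (eq_or_cellDim_lt_of_inside h).resolve_left (Ne.symm hne)
      exact mem_neighbors_comm.1 ((inside_iff_mem_neighbors (by omega)).1 h)
  · intro h
    have hdim := cellDim_of_mem_neighbors h
    refine ⟨fun heq => by rw [heq] at hdim; omega, hdim.imp (fun hdim => ?_) fun hdim => ?_⟩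
    · exact (inside_iff_mem_neighbors hdim).2 h
    · exact (inside_iff_mem_neighbors hdim).2 (mem_neighbors_comm.1 h)

/-- The linear map that sums a function over the neighbours of each cell. -/
def neighborSum : (Cell → ZMod 2) →ₗ[ZMod 2] (Cell → ZMod 2) where
  toFun f c := ∑ d ∈ neighbors c, f d
  map_add' _ _ := funext fun _ => sum_add_distrib
  map_smul' _ _ := funext fun _ => (mul_sum _ _ _).symm

lemma neighborSum_def (f : Cell → ZMod 2) (c : Cell) :
    neighborSum f c = ∑ d ∈ neighbors c, f d := rfl

lemma neighborSum_apply (f : Cell → ZMod 2) (x y z : ℤ) :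
    neighborSum f (x, y, z) = f (x + 1, y, z) + f (x - 1, y, z) +
      (f (x, y + 1, z) + f (x, y - 1, z)) + (f (x, y, z + 1) + f (x, y, z - 1)) := by
  rw [neighborSum_def, neighbors, sum_insert, sum_insert, sum_insert, sum_insert, sum_insert,
    sum_singleton]
  · ring
  all_goals simp only [mem_insert, mem_singleton, Prod.mk.injEq]; omega

/-- A cell at distance two off the axes is reached by two paths, and the cell itself by six. -/
lemma neighborSum_neighborSum (f : Cell → ZMod 2) (x y z : ℤ) :
    neighborSum (neighborSum f) (x, y, z) = f (x + 2, y, z) + f (x - 2, y, z) +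
      (f (x, y + 2, z) + f (x, y - 2, z)) + (f (x, y, z + 2) + f (x, y, z - 2)) := by
  simp only [neighborSum_apply, add_sub_cancel_right, sub_add_cancel, add_assoc, sub_sub,
    show (1 : ℤ) + 1 = 2 from rfl]
  ring_nf
  simp only [show (2 : ZMod 2) = 0 from rfl, show (6 : ZMod 2) = 0 from rfl, mul_zero, add_zero]

lemma neighborSum_single (v c : Cell) :
    neighborSum (Pi.single v 1) c = if v ∈ neighbors c then 1 else 0 := by
  rw [neighborSum_def, sum_pi_single']

/-- The extension by zero of a function on the qubits to all cells. -/
def cellExt : Config L →ₗ[ZMod 2] (Cell → ZMod 2) :=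
  Function.ExtendByZero.linearMap (ZMod 2) Subtype.val

lemma cellExt_val (a : Config L) (i : Qubit L) : cellExt a i.1 = a i :=
  Subtype.val_injective.extend_apply a 0 i

lemma cellExt_of_mem (a : Config L) {c : Cell} (h : c ∈ qubitSites L) : cellExt a c = a ⟨c, h⟩ :=
  cellExt_val a ⟨c, h⟩

lemma cellExt_eq_zero (a : Config L) {c : Cell} (h : c ∉ qubitSites L) : cellExt a c = 0 :=
  Function.extend_apply' a (0 : Cell → ZMod 2) c fun ⟨i, hi⟩ => h (hi ▸ i.2)

lemma sum_eq_sum_cellExt (a : Config L) {S : Finset (Qubit L)} {T : Finset Cell}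
    (h : ∀ i, i ∈ S ↔ i.1 ∈ T) : ∑ i ∈ S, a i = ∑ c ∈ T, cellExt a c := by
  have hmap : ∑ i ∈ S, a i = ∑ c ∈ S.map (Function.Embedding.subtype _), cellExt a c := by
    rw [sum_map]
    exact sum_congr rfl fun i _ => (cellExt_val a i).symm
  rw [hmap]
  refine sum_subset (fun c hc => ?_) fun c hc hc' => cellExt_eq_zero a fun hq => hc' ?_
  · obtain ⟨i, hi, rfl⟩ := mem_map.1 hc
    exact (h i).1 hi
  · exact mem_map.2 ⟨⟨c, hq⟩, (h _).2 hc, rfl⟩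

lemma dotProduct_ind_eq_neighborSum (a : Config L) {S : Finset (Qubit L)} {c : Cell}
    (h : ∀ i, i ∈ S ↔ i.1 ∈ neighbors c) : a ⬝ᵥ ind S = neighborSum (cellExt a) c := by
  rw [dotProduct_ind, sum_eq_sum_cellExt a h, neighborSum_def]

end Cells

section Terms

variable {L : Dims}

/-- The Pauli vector of `clusterTerm i`. -/
def clusterVec (i : Qubit L) : PauliVec (Qubit L) := (ind {i}, ind (nbrs i))

/-- The Pauli vector of `starTerm L v`, as the product of the cluster operators on the star. -/
def starVec (L : Dims) (v : Cell) : PauliVec (Qubit L) := ∑ e ∈ toricStar v, clusterVec e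

/-- The Pauli vector of `plaquetteTerm L f`. -/
def plaquetteVec (L : Dims) (f : Cell) : PauliVec (Qubit L) :=
  (0, ind (univ.filter fun e => cellDim e.1 = 1 ∧ Inside e.1 f))

lemma clusterTerm_eq (i : Qubit L) : clusterTerm i = pauli (clusterVec i) := opX_mul_opZ _ _

lemma plaquetteTerm_eq (f : Cell) : plaquetteTerm L f = pauli (plaquetteVec L f) := opZ_eq_pauli _

lemma mem_toricStar {v : Cell} {e : Qubit L} :
    e ∈ toricStar v ↔ cellDim e.1 = 1 ∧ e.1.1 = 0 ∧ Inside v e.1 := by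
  simp only [toricStar, mem_filter, mem_univ, true_and]

lemma mem_nbrs_of_mem_toricStar {v : Cell} {e i : Qubit L} (he : e ∈ toricStar v) :
    i ∈ nbrs e ↔ i.1 = (1, e.1.2.1, e.1.2.2) := by
  have hdim := (mem_toricStar.1 he).1
  have hx := (mem_toricStar.1 he).2.1
  rw [mem_nbrs]
  obtain ⟨⟨x, y, z⟩, hi⟩ := i
  obtain ⟨⟨x', y', z'⟩, he'⟩ := e
  obtain rfl : x' = 0 := hx
  simp only [cellDim] at hdim
  rw [mem_qubitSites] at hi
  simp only [mem_neighbors, Prod.mk.injEq]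
  omega

lemma pairwiseDisjoint_nbrs_toricStar (v : Cell) :
    ((toricStar v : Finset (Qubit L)) : Set (Qubit L)).PairwiseDisjoint nbrs := by
  refine fun e he e' he' hne => disjoint_left.2 fun i hi hi' => hne (Subtype.ext ?_)
  rw [mem_coe] at he he'
  rw [mem_nbrs_of_mem_toricStar he] at hi
  rw [mem_nbrs_of_mem_toricStar he', hi, Prod.mk.injEq] at hi'
  exact Prod.ext ((mem_toricStar.1 he).2.1.trans (mem_toricStar.1 he').2.1.symm)
    (Prod.ext (Prod.mk.inj hi'.2).1 (Prod.mk.inj hi'.2).2)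

lemma filter_exists_mem_toricStar_eq_biUnion (v : Cell) :
    (univ.filter fun f : Qubit L => cellDim f.1 = 2 ∧ ∃ e ∈ toricStar (L := L) v, Inside e.1 f.1) =
      (toricStar v).biUnion nbrs := by
  ext f
  simp only [mem_filter, mem_univ, true_and, mem_biUnion]
  rw [← exists_and_left]
  refine exists_congr fun e => ?_
  rw [and_left_comm]
  refine and_congr_right fun he => ?_
  have hdim := (mem_toricStar.1 he).1
  rw [mem_nbrs, mem_neighbors_comm]
  refine ⟨fun h => (inside_iff_mem_neighbors (by omega)).1 h.2, fun h => ?_⟩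
  have hf := cellDim_qubit f
  have hadj := cellDim_of_mem_neighbors h
  exact ⟨by omega, (inside_iff_mem_neighbors (by omega)).2 h⟩

lemma starVec_eq (v : Cell) :
    starVec L v = (ind (toricStar v), ind ((toricStar v).biUnion nbrs)) := by
  rw [ind_eq_sum, ind_eq_sum, sum_biUnion (pairwiseDisjoint_nbrs_toricStar v), prod_mk_sum]
  simp only [starVec, clusterVec, ind_eq_sum, sum_singleton]

lemma starTerm_eq (v : Cell) : starTerm L v = pauli (starVec L v) := by
  rw [starTerm, filter_exists_mem_toricStar_eq_biUnion, opX_mul_opZ, starVec_eq]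

/-- The qubits off the toric code facet. -/
def bulkQubits (L : Dims) : Finset (Qubit L) := univ.filter fun i => 0 < i.1.1

/-- The vertices of the toric code facet. -/
def toricVertices (L : Dims) : Finset Cell := (vertices L).filter fun v => v.1 = 0

/-- The faces of the toric code facet. -/
def toricFaces (L : Dims) : Finset Cell := (faces L).filter fun f => f.1 = 0

lemma mem_bulkQubits {i : Qubit L} : i ∈ bulkQubits L ↔ 0 < i.1.1 := by
  simp only [bulkQubits, mem_filter, mem_univ, true_and]

lemma mem_toricVertices {x y z : ℤ} : (x, y, z) ∈ toricVertices L ↔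
    x = 0 ∧ 1 ≤ L.x ∧ (0 ≤ y ∧ y ≤ 2 * L.y) ∧ (1 ≤ z ∧ z ≤ 2 * L.z - 1) ∧ y % 2 = 0 ∧
      z % 2 = 0 := by
  simp only [toricVertices, mem_filter, mem_vertices]
  omega

lemma mem_toricFaces {x y z : ℤ} : (x, y, z) ∈ toricFaces L ↔
    x = 0 ∧ (0 ≤ y ∧ y ≤ 2 * L.y) ∧ (1 ≤ z ∧ z ≤ 2 * L.z - 1) ∧ y % 2 = 1 ∧ z % 2 = 1 := by
  simp only [toricFaces, mem_filter, mem_faces]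
  omega

/-- The labels of the terms of the Hamiltonian. -/
abbrev Term (L : Dims) := bulkQubits L ⊕ toricVertices L ⊕ toricFaces L

instance : DecidableEq (Term L) := instDecidableEqSum

/-- The Pauli vectors of the terms of the Hamiltonian. -/
def termVec : Term L → PauliVec (Qubit L) :=
  Sum.elim (fun i => clusterVec i.1) (Sum.elim (fun v => starVec L v) fun f => plaquetteVec L f)

lemma termVec_cluster (i : bulkQubits L) : termVec (.inl i) = clusterVec i.1 := rfl

lemma termVec_star (v : toricVertices L) : termVec (.inr (.inl v)) = starVec L v := rfl

lemma termVec_plaquette (f : toricFaces L) : termVec (.inr (.inr f)) = plaquetteVec L f := rfl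

lemma hamiltonian_eq_stabilizerHamiltonian (L : Dims) :
    hamiltonian L = stabilizerHamiltonian (termVec (L := L)) := by
  have hcluster := sum_coe_sort (bulkQubits L) fun i => pauli (clusterVec i)
  have hstar := sum_coe_sort (toricVertices L) fun v => pauli (starVec L v)
  have hplaquette := sum_coe_sort (toricFaces L) fun f => pauli (plaquetteVec L f)
  simp only [stabilizerHamiltonian, Fintype.sum_sum_type, termVec_cluster, termVec_star,
    termVec_plaquette]
  rw [hcluster, hstar, hplaquette, neg_add, neg_add, ← sub_eq_add_neg, ← add_sub_assoc,
    ← sub_eq_add_neg]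
  simp only [hamiltonian, clusterTerm_eq, starTerm_eq, plaquetteTerm_eq]
  rfl

end Terms

section Syndrome

variable {L : Dims}

/-- At a qubit `i`, the syndrome tells whether a Pauli operator anticommutes with the cluster
operator `K_i`, where also the edges of the toric code facet are given one. At a face of the toric
code facet it tells whether it anticommutes with the plaquette term. -/
def syndrome : PauliVec (Qubit L) →ₗ[ZMod 2] (Cell → ZMod 2) :=
  cellExt ∘ₗ .snd _ _ _ + neighborSum ∘ₗ cellExt ∘ₗ .fst _ _ _

lemma syndrome_apply (p : PauliVec (Qubit L)) (c : Cell) :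
    syndrome p c = cellExt p.2 c + neighborSum (cellExt p.1) c := rfl

lemma commForm_clusterVec (p : PauliVec (Qubit L)) (i : Qubit L) :
    commForm p (clusterVec i) = syndrome p i.1 := by
  rw [commForm_apply, clusterVec, dotProduct_ind_eq_neighborSum p.1 fun _ => mem_nbrs,
    dotProduct_ind, sum_singleton, syndrome_apply, cellExt_val, add_comm]

lemma commForm_starVec (p : PauliVec (Qubit L)) (v : Cell) :
    commForm p (starVec L v) = ∑ e ∈ toricStar (L := L) v, syndrome p e.1 := by
  simp only [starVec, map_sum, commForm_clusterVec]

lemma commForm_plaquetteVec (p : PauliVec (Qubit L)) {f : Cell} (hf : f ∈ toricFaces L) :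
    commForm p (plaquetteVec L f) = syndrome p f := by
  obtain ⟨x, y, z⟩ := f
  rw [mem_toricFaces] at hf
  have hdim : cellDim (x, y, z) = 1 + 1 := by simp only [cellDim]; omega
  have hsite : (x, y, z) ∉ qubitSites L := by rw [mem_qubitSites]; omega
  rw [commForm_apply, plaquetteVec, dotProduct_zero, add_zero, syndrome_apply,
    cellExt_eq_zero _ hsite, zero_add]
  refine dotProduct_ind_eq_neighborSum _ fun i => ?_
  rw [← cellDim_and_inside_iff hdim le_rfl i, mem_filter]
  exact and_iff_right (mem_univ i)

lemma sum_toricStar (a : Config L) {y z : ℤ} (hy : y % 2 = 0) (hz : z % 2 = 0) :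
    ∑ e ∈ toricStar (0, y, z), a e = cellExt a (0, y + 1, z) + cellExt a (0, y - 1, z) +
      (cellExt a (0, y, z + 1) + cellExt a (0, y, z - 1)) := by
  have hdim : cellDim (0, y, z) = 0 := by simp only [cellDim]; omega
  rw [sum_eq_sum_cellExt a
    (T := {(0, y + 1, z), (0, y - 1, z), (0, y, z + 1), (0, y, z - 1)}) fun e => ?_,
    sum_insert, sum_insert, sum_insert, sum_singleton]
  · ring
  · simp only [mem_singleton, Prod.mk.injEq]; omega
  · simp only [mem_insert, mem_singleton, Prod.mk.injEq]; omega
  · simp only [mem_insert, mem_singleton, Prod.mk.injEq]; omega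
  · rw [mem_toricStar, and_left_comm, cellDim_one_and_inside_iff hdim]
    obtain ⟨⟨x', y', z'⟩, he⟩ := e
    simp only [mem_neighbors, mem_insert, mem_singleton, Prod.mk.injEq]
    omega

lemma commForm_clusterVec_clusterVec (i j : Qubit L) :
    commForm (clusterVec i) (clusterVec j) = 0 := by
  have hsymm : i ∈ nbrs j ↔ j ∈ nbrs i := by rw [mem_nbrs, mem_nbrs, mem_neighbors_comm]
  simp only [commForm_apply, clusterVec, dotProduct_ind, dotProduct_comm (ind {i}), sum_singleton]
  simp only [ind, hsymm]
  exact CharTwo.add_self_eq_zero _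

lemma commForm_clusterVec_starVec (i : Qubit L) (v : Cell) :
    commForm (clusterVec i) (starVec L v) = 0 := by
  rw [starVec, map_sum]
  exact sum_eq_zero fun e _ => commForm_clusterVec_clusterVec i e

lemma commForm_starVec_starVec (v w : Cell) : commForm (starVec L v) (starVec L w) = 0 := by
  rw [starVec, map_sum, LinearMap.sum_apply]
  exact sum_eq_zero fun e _ => commForm_clusterVec_starVec e w

lemma commForm_plaquetteVec_plaquetteVec (f g : Cell) :
    commForm (plaquetteVec L f) (plaquetteVec L g) = 0 := by
  simp only [commForm_apply, plaquetteVec, zero_dotProduct, dotProduct_zero, add_zero]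

lemma commForm_clusterVec_plaquetteVec {i : Qubit L} (hi : i ∈ bulkQubits L) {f : Cell}
    (hf : f ∈ toricFaces L) : commForm (clusterVec i) (plaquetteVec L f) = 0 := by
  rw [commForm_apply, plaquetteVec, clusterVec, dotProduct_zero, add_zero, dotProduct_comm,
    dotProduct_ind, sum_singleton]
  refine if_neg fun h => ?_
  obtain ⟨⟨x, y, z⟩, hsite⟩ := i
  obtain ⟨x', y', z'⟩ := f
  have h := (mem_filter.1 h).2
  rw [mem_bulkQubits] at hi
  rw [inside_iff] at h
  rw [mem_toricFaces] at hf
  simp only [cellDim] at h hi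
  omega

lemma cellExt_starVec_fst {v f c : Cell} (hv : v ∈ toricVertices L) (hf : f ∈ toricFaces L)
    (hc : c ∈ neighbors f) :
    cellExt (starVec L v).1 c = neighborSum (Pi.single v 1 : Cell → ZMod 2) c := by
  obtain ⟨xv, yv, zv⟩ := v
  obtain ⟨xf, yf, zf⟩ := f
  obtain ⟨x, y, z⟩ := c
  rw [mem_toricVertices] at hv
  rw [mem_toricFaces] at hf
  rw [mem_neighbors] at hc
  have hdim : cellDim (xv, yv, zv) = 0 := by simp only [cellDim]; omega
  rw [neighborSum_single]
  by_cases hq : (x, y, z) ∈ qubitSites L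
  · rw [cellExt_of_mem _ hq, starVec_eq]
    refine if_congr ?_ rfl rfl
    rw [mem_toricStar, and_left_comm, cellDim_one_and_inside_iff hdim]
    simp only [mem_neighbors]
    omega
  · rw [cellExt_eq_zero _ hq, if_neg]
    rw [mem_qubitSites] at hq
    rw [mem_neighbors]
    omega

lemma commForm_starVec_plaquetteVec {v f : Cell} (hv : v ∈ toricVertices L)
    (hf : f ∈ toricFaces L) : commForm (starVec L v) (plaquetteVec L f) = 0 := by
  have hsite : f ∉ qubitSites L := by
    obtain ⟨x, y, z⟩ := f
    rw [mem_toricFaces] at hf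
    rw [mem_qubitSites]
    omega
  rw [commForm_plaquetteVec _ hf, syndrome_apply, cellExt_eq_zero _ hsite, zero_add,
    neighborSum_def, sum_congr rfl fun c hc => cellExt_starVec_fst hv hf hc, ← neighborSum_def]
  obtain ⟨xv, yv, zv⟩ := v
  obtain ⟨xf, yf, zf⟩ := f
  rw [mem_toricVertices] at hv
  rw [mem_toricFaces] at hf
  have hodd {x y z : ℤ} (hy : y % 2 = 1) :
      (Pi.single (xv, yv, zv) 1 : Cell → ZMod 2) (x, y, z) = 0 :=
    Pi.single_eq_of_ne (fun h => by simp only [Prod.mk.injEq] at h; omega) 1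
  rw [neighborSum_neighborSum]
  simp only [hodd (show yf % 2 = 1 by omega), hodd (show (yf + 2) % 2 = 1 by omega),
    hodd (show (yf - 2) % 2 = 1 by omega), add_zero]

lemma commForm_termVec_termVec (s t : Term L) : commForm (termVec s) (termVec t) = 0 := by
  rcases s with i | v | f <;> rcases t with j | w | g <;>
    simp only [termVec_cluster, termVec_star, termVec_plaquette]
  · exact commForm_clusterVec_clusterVec _ _
  · exact commForm_clusterVec_starVec _ _
  · exact commForm_clusterVec_plaquetteVec i.2 g.2
  · exact (commForm_comm _ _).trans (commForm_clusterVec_starVec _ _)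
  · exact commForm_starVec_starVec _ _
  · exact commForm_starVec_plaquetteVec v.2 g.2
  · exact (commForm_comm _ _).trans (commForm_clusterVec_plaquetteVec j.2 f.2)
  · exact (commForm_comm _ _).trans (commForm_starVec_plaquetteVec w.2 f.2)
  · exact commForm_plaquetteVec_plaquetteVec _ _

lemma termVec_snd_dotProduct_fst (t : Term L) : (termVec t).2 ⬝ᵥ (termVec t).1 = 0 := by
  rcases t with i | v | f
  · rw [termVec_cluster, clusterVec, dotProduct_ind, sum_singleton]
    exact if_neg fun h => (mem_filter.1 h).2.1 rfl
  · rw [termVec_star, starVec_eq, ← filter_exists_mem_toricStar_eq_biUnion, dotProduct_ind]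
    refine sum_eq_zero fun e he => if_neg fun h => ?_
    have hone := (mem_toricStar.1 he).1
    have htwo := (mem_filter.1 h).2.1
    omega
  · exact dotProduct_zero _

end Syndrome

section Duals

variable {L : Dims}

lemma commForm_starVec_of_fst_eq_zero {p : PauliVec (Qubit L)} (hp : p.1 = 0) (v : Cell) :
    commForm p (starVec L v) = ∑ e ∈ toricStar v, p.2 e := by
  rw [commForm_starVec]
  refine sum_congr rfl fun e _ => ?_
  rw [syndrome_apply, hp, map_zero, map_zero, Pi.zero_apply, add_zero, cellExt_val]

lemma commForm_clusterVec_of_fst_eq_zero {p : PauliVec (Qubit L)} (hp : p.1 = 0) (i : Qubit L) :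
    commForm p (clusterVec i) = p.2 i := by
  rw [commForm_clusterVec, syndrome_apply, hp, map_zero, map_zero, Pi.zero_apply, add_zero,
    cellExt_val]

lemma commForm_plaquetteVec_of_fst_eq_zero {p : PauliVec (Qubit L)} (hp : p.1 = 0) (f : Cell) :
    commForm p (plaquetteVec L f) = 0 := by
  rw [commForm_apply, hp, zero_dotProduct, zero_add, plaquetteVec, dotProduct_zero]

lemma commForm_single_eq_single (i : bulkQubits L) :
    (fun t => commForm (0, Pi.single i.1 1) (termVec t)) = Pi.single (Sum.inl i : Term L) 1 := by
  funext t
  rcases t with j | v | f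
  · rw [termVec_cluster, commForm_clusterVec_of_fst_eq_zero rfl]
    simp only [Pi.single_apply, Sum.inl.injEq, Subtype.ext_iff]
  · rw [termVec_star, commForm_starVec_of_fst_eq_zero rfl, Pi.single_eq_of_ne Sum.inr_ne_inl]
    refine sum_eq_zero fun e he => Pi.single_eq_of_ne (fun h => ?_) 1
    have hx := (mem_toricStar.1 he).2.1
    have hi := mem_bulkQubits.1 i.2
    rw [h] at hx
    omega
  · rw [termVec_plaquette, commForm_plaquetteVec_of_fst_eq_zero rfl,
      Pi.single_eq_of_ne Sum.inr_ne_inl]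

/-- The edges of the toric code facet on the line from the rough edge `z = 0` to the vertex `v`. -/
def toricString (L : Dims) (v : Cell) : Finset (Qubit L) :=
  univ.filter fun e => cellDim e.1 = 1 ∧ e.1.1 = 0 ∧ e.1.2.1 = v.2.1 ∧ e.1.2.2 < v.2.2

lemma sum_toricStar_ind_toricString {v w : Cell} (hv : v ∈ toricVertices L)
    (hw : w ∈ toricVertices L) :
    ∑ e ∈ toricStar w, ind (toricString L v) e = if w = v then 1 else 0 := by
  obtain ⟨xv, yv, zv⟩ := v
  obtain ⟨xw, yw, zw⟩ := w
  rw [mem_toricVertices] at hv hw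
  obtain rfl : xw = 0 := hw.1
  have hext {y z : ℤ} (h : (0, y, z) ∈ qubitSites L) :
      cellExt (ind (toricString L (xv, yv, zv))) (0, y, z) = if y = yv ∧ z < zv then 1 else 0 := by
    rw [cellExt_of_mem _ h]
    refine if_congr ?_ rfl rfl
    rw [mem_qubitSites] at h
    simp only [toricString, mem_filter, mem_univ, true_and, cellDim]
    omega
  have hodd {y z : ℤ} (hy : y % 2 = 1) :
      cellExt (ind (toricString L (xv, yv, zv))) (0, y, z) = 0 := by
    by_cases h : (0, y, z) ∈ qubitSites L
    · rw [hext h, if_neg (by omega)]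
    · exact cellExt_eq_zero _ h
  rw [sum_toricStar _ (by omega) (by omega), hodd (by omega), hodd (by omega),
    hext (by rw [mem_qubitSites]; omega), hext (by rw [mem_qubitSites]; omega), add_zero, zero_add]
  simp only [Prod.mk.injEq]
  split_ifs <;> first | rfl | omega

lemma commForm_toricString_eq_single (v : toricVertices L) :
    (fun t => commForm (0, ind (toricString L v)) (termVec t)) =
      Pi.single (Sum.inr (Sum.inl v) : Term L) 1 := by
  funext t
  rcases t with j | w | f
  · rw [termVec_cluster, commForm_clusterVec_of_fst_eq_zero rfl,
      Pi.single_eq_of_ne Sum.inl_ne_inr]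
    have hj := mem_bulkQubits.1 j.2
    exact if_neg fun h => hj.ne' (mem_filter.1 h).2.2.1
  · rw [termVec_star, commForm_starVec_of_fst_eq_zero rfl,
      sum_toricStar_ind_toricString v.2 w.2]
    simp only [Pi.single_apply, Sum.inr.injEq, Sum.inl.injEq, Subtype.ext_iff]
  · rw [termVec_plaquette, commForm_plaquetteVec_of_fst_eq_zero rfl,
      Pi.single_eq_of_ne (by simp)]

lemma isStabilizerFamily_termVec (L : Dims) : IsStabilizerFamily (termVec (L := L)) where
  commForm_eq_zero := commForm_termVec_termVec
  dotProduct_eq_zero := termVec_snd_dotProduct_fst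
  codeSpace_ne_bot := by
    refine codeSpace_ne_bot_of_exists_dual commForm_termVec_termVec termVec_snd_dotProduct_fst ?_
    rintro (i | v | f) h
    · exact ⟨_, commForm_single_eq_single i⟩
    · exact ⟨_, commForm_toricString_eq_single v⟩
    · exact absurd rfl h

theorem energyGap_hamiltonian (hx : 1 ≤ L.x) (hz : 1 ≤ L.z) : energyGap (hamiltonian L) = 2 := by
  have hsite : (1, 0, 1) ∈ qubitSites L := by rw [mem_qubitSites]; omega
  have hbulk : (⟨(1, 0, 1), hsite⟩ : Qubit L) ∈ bulkQubits L := mem_bulkQubits.2 one_pos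
  rw [hamiltonian_eq_stabilizerHamiltonian]
  refine (isStabilizerFamily_termVec L).energyGap_eq ⟨(0, Pi.single ⟨(1, 0, 1), hsite⟩ 1), ?_⟩
  rw [commForm_single_eq_single ⟨_, hbulk⟩]
  refine card_eq_one.2 ⟨Sum.inl ⟨_, hbulk⟩, ?_⟩
  ext t
  simp [Pi.single_apply]

end Duals

section Potential

/-- The line integral of `F` along the first coordinate, from `0` to `s`: a solution of the discrete
equation `dw = F` when `F` is closed. -/
def potential (F : ℤ → ℤ → ZMod 2) (s t : ℤ) : ZMod 2 := ∑ l ∈ range (s / 2).toNat, F (2 * l + 1) t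

lemma potential_zero (F : ℤ → ℤ → ZMod 2) (t : ℤ) : potential F 0 t = 0 := sum_range_zero _

lemma potential_two_mul_natCast (F : ℤ → ℤ → ZMod 2) (n : ℕ) (t : ℤ) :
    potential F (2 * n) t = ∑ l ∈ range n, F (2 * l + 1) t := by
  rw [potential, show (2 * (n : ℤ) / 2).toNat = n by omega]

lemma potential_succ_add_pred (F : ℤ → ℤ → ZMod 2) {s : ℤ} (hs : s % 2 = 1) (hs₀ : 0 ≤ s) (t : ℤ) :
    potential F (s + 1) t + potential F (s - 1) t = F s t := by
  obtain ⟨n, rfl⟩ : ∃ n : ℕ, s = 2 * n + 1 := ⟨(s / 2).toNat, by omega⟩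
  rw [show 2 * (n : ℤ) + 1 + 1 = 2 * (n + 1 : ℕ) by omega, add_sub_cancel_right,
    potential_two_mul_natCast, potential_two_mul_natCast, sum_range_succ, add_right_comm,
    CharTwo.add_self_eq_zero, zero_add]

lemma potential_add_potential {F : ℤ → ℤ → ZMod 2} {s t : ℤ} (hs : s % 2 = 0) (hs₀ : 0 ≤ s)
    (hF : ∀ m, m % 2 = 1 → 0 ≤ m → m < s →
      F m (t + 1) + F m (t - 1) + (F (m + 1) t + F (m - 1) t) = 0) :
    potential F s (t + 1) + potential F s (t - 1) = F s t + F 0 t := by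
  obtain ⟨n, rfl⟩ : ∃ n : ℕ, s = 2 * n := ⟨(s / 2).toNat, by omega⟩
  rw [potential_two_mul_natCast, potential_two_mul_natCast, ← sum_add_distrib]
  have htelescope := sum_range_sub (fun l : ℕ => F (2 * l) t) n
  simp only [CharTwo.sub_eq_add, Nat.cast_zero, mul_zero] at htelescope
  rw [← htelescope]
  refine sum_congr rfl fun l hl => ?_
  have h := hF (2 * l + 1) (by omega) (by omega) (by rw [mem_range] at hl; omega)
  rw [add_assoc (2 * (l : ℤ)), add_sub_cancel_right] at h
  exact CharTwo.add_eq_zero.1 h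

end Potential

section Completeness

variable {L : Dims}

/-- The parity of the number of cluster operators, on the edges of the toric code facet in the plane
`z = 2 * k + 1`, with which `p` anticommutes: excitations of `Z` type cross the facet there. -/
def zCrossing (p : PauliVec (Qubit L)) (k : ℕ) : ZMod 2 :=
  ∑ j ∈ range (L.y + 1), syndrome p (0, 2 * j, 2 * k + 1)

/-- The parity of the number of edges of the toric code facet in the plane `y = 2 * k` on which `p`
acts by `X` or `Y`: excitations of `X` type cross the facet there. -/
def yCrossing (p : PauliVec (Qubit L)) (k : ℕ) : ZMod 2 :=
  ∑ l ∈ range L.z, cellExt p.1 (0, 2 * k, 2 * l + 1)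

lemma zCrossing_add (p q : PauliVec (Qubit L)) (k : ℕ) :
    zCrossing (p + q) k = zCrossing p k + zCrossing q k := by
  simp only [zCrossing, map_add, Pi.add_apply, sum_add_distrib]

lemma yCrossing_add (p q : PauliVec (Qubit L)) (k : ℕ) :
    yCrossing (p + q) k = yCrossing p k + yCrossing q k := by
  simp only [yCrossing, Prod.fst_add, map_add, Pi.add_apply, sum_add_distrib]

lemma zCrossing_eq_zero_of_commForm_clusterVec (hx : 1 ≤ L.x) {p : PauliVec (Qubit L)}
    (hp : ∀ i, commForm p (clusterVec i) = 0) {k : ℕ} (hk : k < L.z) : zCrossing p k = 0 := by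
  refine sum_eq_zero fun j hj => ?_
  have hsite : (0, 2 * (j : ℤ), 2 * (k : ℤ) + 1) ∈ qubitSites L := by
    rw [mem_range] at hj
    rw [mem_qubitSites]
    omega
  rw [← commForm_clusterVec p ⟨_, hsite⟩, hp]

lemma sum_ite_mem_neighbors (w : Cell → ZMod 2) (S : Finset Cell) (c : Cell) :
    ∑ d ∈ S, (if c ∈ neighbors d then w d else 0) =
      neighborSum (fun d => if d ∈ S then w d else 0) c := by
  rw [neighborSum_def, ← sum_filter, ← sum_filter]
  refine sum_congr ?_ fun _ _ => rfl
  ext d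
  rw [mem_filter, mem_filter, mem_neighbors_comm, and_comm]

lemma commForm_plaquetteVec_eq (p : PauliVec (Qubit L)) {y z : ℤ} (hf : (0, y, z) ∈ toricFaces L) :
    commForm p (plaquetteVec L (0, y, z)) = cellExt p.1 (0, y + 1, z) + cellExt p.1 (0, y - 1, z) +
      (cellExt p.1 (0, y, z + 1) + cellExt p.1 (0, y, z - 1)) := by
  rw [commForm_plaquetteVec p hf, syndrome_apply, neighborSum_apply]
  rw [mem_toricFaces] at hf
  have hzero {c : Cell} (hc : c ∉ qubitSites L) (a : Config L) : cellExt a c = 0 :=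
    cellExt_eq_zero a hc
  rw [hzero (by rw [mem_qubitSites]; omega), hzero (by rw [mem_qubitSites]; omega),
    hzero (by rw [mem_qubitSites]; omega)]
  simp only [zero_add]

lemma exists_vertex_potential {p : PauliVec (Qubit L)}
    (hp : ∀ f ∈ toricFaces L, commForm p (plaquetteVec L f) = 0)
    (hy : ∀ k ≤ L.y, yCrossing p k = 0) :
    ∃ w : Cell → ZMod 2, ∀ e : Qubit L, e.1.1 = 0 →
      neighborSum (fun v => if v ∈ toricVertices L then w v else 0) e.1 = p.1 e := by
  set F : ℤ → ℤ → ZMod 2 := fun s t => cellExt p.1 (0, t, s)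
  have hclosed {y z : ℤ} (hf : (0, y, z) ∈ toricFaces L) :
      F z (y + 1) + F z (y - 1) + (F (z + 1) y + F (z - 1) y) = 0 := by
    rw [← hp _ hf, commForm_plaquetteVec_eq p hf]
  have htop {y : ℤ} (h : 0 ≤ y ∧ y ≤ 2 * L.y ∧ y % 2 = 0) : potential F (2 * L.z) y = 0 := by
    rw [potential_two_mul_natCast, ← hy (y / 2).toNat (by omega), yCrossing,
      show 2 * ((y / 2).toNat : ℤ) = y by omega]
  refine ⟨fun v => potential F v.2.2 v.2.1, ?_⟩
  rintro ⟨⟨x, y, z⟩, he⟩ rfl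
  rw [← cellExt_val p.1]
  rw [mem_qubitSites] at he
  have hoff {x y z : ℤ} (h : x ≠ 0 ∨ y % 2 = 1 ∨ z % 2 = 1) : (x, y, z) ∉ toricVertices L := by
    rw [mem_toricVertices]; omega
  have hon {y z : ℤ} (h : 0 ≤ y ∧ y ≤ 2 * L.y ∧ y % 2 = 0) (h' : 0 ≤ z ∧ z ≤ 2 * L.z ∧ z % 2 = 0) :
      (if (0, y, z) ∈ toricVertices L then potential F z y else 0) = potential F z y := by
    refine ite_eq_left_iff.2 fun hv => ?_
    obtain rfl | rfl : z = 0 ∨ z = 2 * L.z := by rw [mem_toricVertices] at hv; omega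
    · exact (potential_zero F y).symm
    · exact (htop h).symm
  rw [neighborSum_apply, if_neg (hoff (by omega)), if_neg (hoff (by omega)), add_zero, zero_add]
  obtain hz | hz : z % 2 = 1 ∨ z % 2 = 0 := by omega
  · rw [if_neg (hoff (by omega)), if_neg (hoff (by omega)), hon (by omega) (by omega),
      hon (by omega) (by omega), add_zero, zero_add]
    exact potential_succ_add_pred F hz (by omega) y
  · rw [if_neg (hoff (z := z + 1) (by omega)), if_neg (hoff (z := z - 1) (by omega)),
      hon (by omega) (by omega), hon (by omega) (by omega), add_zero, add_zero,
      potential_add_potential hz (by omega) fun m _ _ _ => hclosed (by rw [mem_toricFaces]; omega)]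
    exact add_eq_left.2 (cellExt_eq_zero _ (by rw [mem_qubitSites]; omega))

lemma fst_nonneg (i : Qubit L) : 0 ≤ i.1.1 := (mem_qubitSites.1 i.2).1.1.1

lemma starVec_fst_apply {v : Cell} (hv : v ∈ toricVertices L) (e : Qubit L) :
    (starVec L v).1 e = if e.1.1 = 0 ∧ e.1 ∈ neighbors v then 1 else 0 := by
  have hdim : cellDim v = 0 := (mem_filter.1 (mem_filter.1 hv).1).2.1
  rw [starVec_eq]
  refine if_congr ?_ rfl rfl
  rw [mem_toricStar, and_left_comm, cellDim_one_and_inside_iff hdim]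

lemma plaquetteVec_snd_apply {f : Cell} (hf : f ∈ toricFaces L) (e : Qubit L) :
    (plaquetteVec L f).2 e = if e.1.1 = 0 ∧ e.1 ∈ neighbors f then 1 else 0 := by
  have hdim : cellDim f = 1 + 1 := (mem_filter.1 (mem_filter.1 hf).1).2
  refine if_congr ?_ rfl rfl
  rw [mem_filter, cellDim_and_inside_iff hdim le_rfl]
  refine (and_iff_right (mem_univ e)).trans (iff_and_self.2 fun h => ?_)
  obtain ⟨⟨x, y, z⟩, he⟩ := e
  obtain ⟨x', y', z'⟩ := f
  rw [mem_toricFaces] at hf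
  rw [mem_neighbors] at h
  rw [mem_qubitSites] at he
  change x = 0
  omega

lemma exists_mem_span_fst_eq {p : PauliVec (Qubit L)}
    (hp : ∀ f ∈ toricFaces L, commForm p (plaquetteVec L f) = 0)
    (hy : ∀ k ≤ L.y, yCrossing p k = 0) :
    ∃ q ∈ Submodule.span (ZMod 2) (Set.range (termVec (L := L))),
      (∀ i, commForm q (clusterVec i) = 0) ∧ q.1 = p.1 := by
  obtain ⟨w, hw⟩ := exists_vertex_potential hp hy
  refine ⟨∑ i ∈ bulkQubits L, p.1 i • clusterVec i + ∑ v ∈ toricVertices L, w v • starVec L v,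
    add_mem (sum_mem fun i hi => ?_) (sum_mem fun v hv => ?_), fun i => ?_, ?_⟩
  · exact Submodule.smul_mem _ _ (Submodule.subset_span ⟨.inl ⟨i, hi⟩, rfl⟩)
  · exact Submodule.smul_mem _ _ (Submodule.subset_span ⟨.inr (.inl ⟨v, hv⟩), rfl⟩)
  · rw [commForm_comm]
    simp only [map_add, map_sum, map_smul, commForm_clusterVec_clusterVec,
      commForm_clusterVec_starVec, smul_zero, sum_const_zero, add_zero]
  · funext e
    simp only [Prod.fst_add, Prod.fst_sum, Prod.smul_fst, Pi.add_apply, Finset.sum_apply,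
      Pi.smul_apply, smul_eq_mul]
    have hcluster : ∑ i ∈ bulkQubits L, p.1 i * (clusterVec i).1 e =
        if e ∈ bulkQubits L then p.1 e else 0 := by
      simp only [clusterVec, ind, mem_singleton, mul_ite, mul_one, mul_zero, sum_ite_eq]
    have hstar : ∑ v ∈ toricVertices L, w v * (starVec L v).1 e =
        if e.1.1 = 0 then p.1 e else 0 := by
      split_ifs with he
      · rw [← hw e he, ← sum_ite_mem_neighbors]
        refine sum_congr rfl fun v hv => ?_
        rw [starVec_fst_apply hv]
        simp only [he, true_and, mul_ite, mul_one, mul_zero]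
      · exact sum_eq_zero fun v hv => by rw [starVec_fst_apply hv, if_neg (he ·.1), mul_zero]
    rw [hcluster, hstar]
    obtain he | he := (fst_nonneg e).eq_or_lt
    · rw [if_neg fun h => (mem_bulkQubits.1 h).ne he, if_pos he.symm, zero_add]
    · rw [if_pos (mem_bulkQubits.2 he), if_neg he.ne', add_zero]

lemma commForm_starVec_eq {p : PauliVec (Qubit L)} (hp₁ : p.1 = 0) {y z : ℤ}
    (hv : (0, y, z) ∈ toricVertices L) :
    commForm p (starVec L (0, y, z)) = cellExt p.2 (0, y, z + 1) + cellExt p.2 (0, y, z - 1) +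
      (cellExt p.2 (0, y + 1, z) + cellExt p.2 (0, y - 1, z)) := by
  rw [commForm_starVec_of_fst_eq_zero hp₁]
  rw [mem_toricVertices] at hv
  rw [sum_toricStar _ (by omega) (by omega), add_comm]

lemma exists_face_potential {p : PauliVec (Qubit L)} (hp₁ : p.1 = 0)
    (hp : ∀ v ∈ toricVertices L, commForm p (starVec L v) = 0)
    (hz : ∀ k < L.z, zCrossing p k = 0) :
    ∃ w : Cell → ZMod 2, ∀ e : Qubit L, e.1.1 = 0 →
      neighborSum (fun f => if f ∈ toricFaces L then w f else 0) e.1 = p.2 e := by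
  set F : ℤ → ℤ → ZMod 2 := fun s t => cellExt p.2 (0, s - 1, t) with hF
  have hclosed {y z : ℤ} (hv : (0, y, z) ∈ toricVertices L) :
      F (y + 1) (z + 1) + F (y + 1) (z - 1) + (F (y + 1 + 1) z + F (y + 1 - 1) z) = 0 := by
    rw [← hp _ hv, commForm_starVec_eq hp₁ hv]
    simp only [hF, add_sub_cancel_right]
  have htop {z : ℤ} (h : 1 ≤ z ∧ z ≤ 2 * L.z - 1 ∧ z % 2 = 1) :
      potential F (2 * (L.y + 1 : ℕ)) z = 0 := by
    rw [potential_two_mul_natCast, ← hz (z / 2).toNat (by omega), zCrossing,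
      show 2 * ((z / 2).toNat : ℤ) + 1 = z by omega]
    simp only [hF, add_sub_cancel_right, syndrome_apply, hp₁, map_zero, Pi.zero_apply, add_zero]
  refine ⟨fun f => potential F (f.2.1 + 1) f.2.2, ?_⟩
  rintro ⟨⟨x, y, z⟩, he⟩ rfl
  rw [← cellExt_val p.2]
  rw [mem_qubitSites] at he
  have hoff {x y z : ℤ} (h : x ≠ 0 ∨ y % 2 = 0 ∨ z % 2 = 0) : (x, y, z) ∉ toricFaces L := by
    rw [mem_toricFaces]; omega
  have hon {y z : ℤ} (h : -1 ≤ y ∧ y ≤ 2 * L.y + 1 ∧ y % 2 = 1)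
      (h' : 1 ≤ z ∧ z ≤ 2 * L.z - 1 ∧ z % 2 = 1) :
      (if (0, y, z) ∈ toricFaces L then potential F (y + 1) z else 0) = potential F (y + 1) z := by
    refine ite_eq_left_iff.2 fun hf => ?_
    obtain rfl | rfl : y = -1 ∨ y = 2 * L.y + 1 := by rw [mem_toricFaces] at hf; omega
    · exact (potential_zero F z).symm
    · exact (htop h').symm
  rw [neighborSum_apply, if_neg (hoff (by omega)), if_neg (hoff (by omega)), add_zero, zero_add]
  obtain hy | hy : y % 2 = 0 ∨ y % 2 = 1 := by omega
  · rw [if_neg (hoff (z := z + 1) (by omega)), if_neg (hoff (z := z - 1) (by omega)),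
      hon (by omega) (by omega), hon (by omega) (by omega), add_zero, add_zero]
    rw [show y - 1 + 1 = y + 1 - 1 by ring, potential_succ_add_pred F (by omega) (by omega) z]
    simp only [hF, add_sub_cancel_right]
  · rw [if_neg (hoff (by omega)), if_neg (hoff (by omega)), hon (by omega) (by omega),
      hon (by omega) (by omega), add_zero, zero_add,
      potential_add_potential (by omega) (by omega) fun m _ _ _ => ?_]
    · simp only [hF, add_sub_cancel_right]
      exact add_eq_left.2 (cellExt_eq_zero _ (by rw [mem_qubitSites]; omega))
    · obtain ⟨y', rfl⟩ : ∃ y', m = y' + 1 := ⟨m - 1, (sub_add_cancel m 1).symm⟩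
      exact hclosed (by rw [mem_toricVertices]; omega)

lemma mem_span_range_termVec_of_fst_eq_zero {p : PauliVec (Qubit L)} (hp₁ : p.1 = 0)
    (hp : ∀ t : Term L, commForm p (termVec t) = 0) (hz : ∀ k < L.z, zCrossing p k = 0) :
    p ∈ Submodule.span (ZMod 2) (Set.range (termVec (L := L))) := by
  obtain ⟨w, hw⟩ := exists_face_potential hp₁ (fun v hv => hp (.inr (.inl ⟨v, hv⟩))) hz
  suffices h : p = ∑ f ∈ toricFaces L, w f • plaquetteVec L f by
    rw [h]
    exact sum_mem fun f hf =>
      Submodule.smul_mem _ _ (Submodule.subset_span ⟨.inr (.inr ⟨f, hf⟩), rfl⟩)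
  refine Prod.ext ?_ (funext fun e => ?_)
  · simp only [hp₁, Prod.fst_sum, Prod.smul_fst, plaquetteVec, smul_zero, sum_const_zero]
  · simp only [Prod.snd_sum, Prod.smul_snd, Finset.sum_apply, Pi.smul_apply, smul_eq_mul]
    obtain he | he := (fst_nonneg e).eq_or_lt
    · rw [← hw e he.symm, ← sum_ite_mem_neighbors]
      refine sum_congr rfl fun f hf => ?_
      rw [plaquetteVec_snd_apply hf]
      simp only [he.symm, true_and, mul_ite, mul_one, mul_zero]
    · rw [← commForm_clusterVec_of_fst_eq_zero hp₁]
      refine (hp (.inl ⟨e, mem_bulkQubits.2 he⟩)).trans (sum_eq_zero fun f hf => ?_).symm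
      rw [plaquetteVec_snd_apply hf, if_neg fun h => he.ne' h.1, mul_zero]

theorem mem_span_range_termVec (hx : 1 ≤ L.x) {p : PauliVec (Qubit L)}
    (hp : ∀ t : Term L, commForm p (termVec t) = 0) (hy : ∀ k ≤ L.y, yCrossing p k = 0)
    (hz : ∀ k < L.z, zCrossing p k = 0) :
    p ∈ Submodule.span (ZMod 2) (Set.range (termVec (L := L))) := by
  obtain ⟨q, hq, hqc, hqp⟩ := exists_mem_span_fst_eq (fun f hf => hp (.inr (.inr ⟨f, hf⟩))) hy
  have hqt (t : Term L) : commForm q (termVec t) = 0 := by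
    rw [commForm_comm]
    exact commForm_eq_zero_of_mem_span (Set.forall_mem_range.2 (commForm_termVec_termVec t)) hq
  have hsub : p - q ∈ Submodule.span (ZMod 2) (Set.range (termVec (L := L))) := by
    refine mem_span_range_termVec_of_fst_eq_zero (sub_eq_zero.2 hqp.symm) (fun t => ?_)
      fun k hk => ?_
    · rw [map_sub, LinearMap.sub_apply, hp, hqt, sub_zero]
    · rw [ZModModule.sub_eq_add, zCrossing_add, hz k hk,
        zCrossing_eq_zero_of_commForm_clusterVec hx hqc hk, add_zero]
  exact sub_add_cancel p q ▸ add_mem hsub hq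

end Completeness

section Conservation

variable {L : Dims}

/-- The conservation law imposed on the `Z` part of a Pauli operator by the 1-form symmetries. -/
def IsSymmetric (p : PauliVec (Qubit L)) : Prop :=
  ∀ c ∈ vertices L ∪ cubes L, neighborSum (cellExt p.2) c = 0

/-- The qubits off the toric code facet whose cluster operator anticommutes with `p`. -/
def violatedCells (p : PauliVec (Qubit L)) : Finset Cell :=
  (qubitSites L).filter fun c => 0 < c.1 ∧ syndrome p c ≠ 0

lemma syndrome_eq_zero {p : PauliVec (Qubit L)} {c : Cell} (hc : cellExt p.2 c = 0)
    (h : ∀ d ∈ neighbors c, cellExt p.1 d = 0) : syndrome p c = 0 := by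
  rw [syndrome_apply, hc, zero_add]
  exact sum_eq_zero h

lemma syndrome_eq_zero_of_notMem_qubitSites (p : PauliVec (Qubit L)) {c : Cell}
    (hc : c ∉ qubitSites L) (h : ∀ d ∈ neighbors c, d ∉ qubitSites L) : syndrome p c = 0 :=
  syndrome_eq_zero (cellExt_eq_zero _ hc) fun d hd => cellExt_eq_zero _ (h d hd)

lemma syndrome_eq_zero_of_notMem_violatedCells {p : PauliVec (Qubit L)} {c : Cell}
    (hc : c ∈ qubitSites L) (hx : 0 < c.1) (h : c ∉ violatedCells p) : syndrome p c = 0 :=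
  not_not.1 fun h₀ => h (mem_filter.2 ⟨hc, hx, h₀⟩)

lemma neighborSum_syndrome (p : PauliVec (Qubit L)) {x y z : ℤ}
    (hd : x % 2 + y % 2 + z % 2 = 0 ∨ x % 2 + y % 2 + z % 2 = 3) :
    neighborSum (syndrome p) (x, y, z) = neighborSum (cellExt p.2) (x, y, z) := by
  have hzero {x' y' z' : ℤ} (h : x' % 2 + y' % 2 + z' % 2 = x % 2 + y % 2 + z % 2) :
      cellExt p.1 (x', y', z') = 0 := cellExt_eq_zero _ (by rw [mem_qubitSites]; omega)
  have hsum : syndrome p = cellExt p.2 + neighborSum (cellExt p.1) := rfl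
  rw [hsum, map_add, Pi.add_apply, neighborSum_neighborSum, hzero (by omega), hzero (by omega),
    hzero (by omega), hzero (by omega), hzero (by omega), hzero (by omega)]
  simp only [add_zero]

lemma IsSymmetric.neighborSum_syndrome_vertex {p : PauliVec (Qubit L)} (hp : IsSymmetric p)
    {x y z : ℤ} (h : (x, y, z) ∈ vertices L) : neighborSum (syndrome p) (x, y, z) = 0 := by
  rw [neighborSum_syndrome p (Or.inl (mem_vertices.1 h).2.1), hp _ (mem_union_left _ h)]

/-- The cells at `x = -1` behave as volumes, since the faces at `x = 0` carry no qubit. -/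
lemma IsSymmetric.neighborSum_syndrome_cube {p : PauliVec (Qubit L)} (hp : IsSymmetric p)
    {x y z : ℤ} (h : (x, y, z) ∈ cubes L ∨ x = -1 ∧ y % 2 = 1 ∧ z % 2 = 1) :
    neighborSum (syndrome p) (x, y, z) = 0 := by
  rw [mem_cubes] at h
  rw [neighborSum_syndrome p (Or.inr (by omega))]
  obtain h | ⟨rfl, hy, hz⟩ := h
  · exact hp _ (mem_union_right _ (mem_cubes.2 h))
  · rw [neighborSum_def]
    refine sum_eq_zero fun ⟨x', y', z'⟩ hd => cellExt_eq_zero _ ?_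
    rw [mem_neighbors] at hd
    rw [mem_qubitSites]
    omega

end Conservation

section Flux

lemma sum_sum_eq_of_divergence_eq_zero {A : Type*} [AddCommGroup A] {N m n : ℕ}
    {F G H : ℕ → ℕ → ℕ → A}
    (h : ∀ k < N, ∀ i < m, ∀ j < n, G k (i + 1) j - G k i j + (H k i (j + 1) - H k i j) +
      (F (k + 1) i j - F k i j) = 0)
    (hG₀ : ∀ k < N, ∀ j < n, G k 0 j = 0) (hG : ∀ k < N, ∀ j < n, G k m j = 0)
    (hH₀ : ∀ k < N, ∀ i < m, H k i 0 = 0) (hH : ∀ k < N, ∀ i < m, H k i n = 0) :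
    ∀ k ≤ N, ∑ i ∈ range m, ∑ j ∈ range n, F k i j = ∑ i ∈ range m, ∑ j ∈ range n, F 0 i j := by
  intro k hk
  induction k with
  | zero => rfl
  | succ k ih =>
    refine Eq.trans (sub_eq_zero.1 ?_) (ih (by omega))
    have hdiv : ∑ i ∈ range m, ∑ j ∈ range n, (G k (i + 1) j - G k i j +
        (H k i (j + 1) - H k i j) + (F (k + 1) i j - F k i j)) = 0 :=
      sum_eq_zero fun i hi => sum_eq_zero fun j hj =>
        h k hk i (mem_range.1 hi) j (mem_range.1 hj)
    have hGsum : ∑ i ∈ range m, ∑ j ∈ range n, (G k (i + 1) j - G k i j) = 0 := by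
      rw [sum_comm]
      refine sum_eq_zero fun j hj => ?_
      rw [sum_range_sub fun i => G k i j, hG k hk j (mem_range.1 hj),
        hG₀ k hk j (mem_range.1 hj), sub_zero]
    have hHsum : ∑ i ∈ range m, ∑ j ∈ range n, (H k i (j + 1) - H k i j) = 0 := by
      refine sum_eq_zero fun i hi => ?_
      rw [sum_range_sub, hH k hk i (mem_range.1 hi), hH₀ k hk i (mem_range.1 hi), sub_zero]
    simp only [sum_add_distrib] at hdiv
    rw [hGsum, hHsum, zero_add, zero_add] at hdiv
    simpa only [sum_sub_distrib] using hdiv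

variable {L : Dims} {p : PauliVec (Qubit L)} {m : ℕ}

lemma zFlux_eq (hp : IsSymmetric p) (hm : m < L.x) (hfree : ∀ c ∈ violatedCells p, c.1 ≠ 2 * m + 1)
    {k : ℕ} (hk : k < L.z) :
    ∑ i ∈ range (m + 1), ∑ j ∈ range (L.y + 1), syndrome p (2 * i, 2 * j, 2 * k + 1) =
      ∑ i ∈ range (m + 1), ∑ j ∈ range (L.y + 1), syndrome p (2 * i, 2 * j, 1) := by
  have houtside {x y z : ℤ} (h : x < 0 ∨ y < 0 ∨ 2 * L.y < y) (hd : x % 2 + y % 2 + z % 2 = 1) :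
      syndrome p (x, y, z) = 0 := by
    refine syndrome_eq_zero_of_notMem_qubitSites p ?_ ?_
    · rw [mem_qubitSites]; omega
    · rintro ⟨x', y', z'⟩ hn
      rw [mem_neighbors] at hn
      rw [mem_qubitSites]
      omega
  refine sum_sum_eq_of_divergence_eq_zero (N := L.z - 1)
    (F := fun k i j => syndrome p (2 * i, 2 * j, 2 * k + 1))
    (G := fun k i j => syndrome p (2 * i - 1, 2 * j, 2 * k + 2))
    (H := fun k i j => syndrome p (2 * i, 2 * j - 1, 2 * k + 2)) ?_ ?_ ?_ ?_ ?_ k (by omega)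
  · intro k hk i hi j hj
    have h := hp.neighborSum_syndrome_vertex (x := 2 * i) (y := 2 * j) (z := 2 * k + 2)
      (by rw [mem_vertices]; omega)
    rw [neighborSum_apply] at h
    simp only [CharTwo.sub_eq_add]
    convert h using 6 <;> push_cast <;> ring_nf
  · exact fun _ _ _ _ => houtside (by omega) (by omega)
  · intro k hk j hj
    refine syndrome_eq_zero_of_notMem_violatedCells ?_ ?_ fun h => hfree _ h ?_
    · rw [mem_qubitSites]; omega
    · simp only; omega
    · simp only; omega
  · exact fun _ _ _ _ => houtside (by omega) (by omega)
  · exact fun _ _ _ _ => houtside (by omega) (by omega)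

lemma zFlux_eq_zCrossing (hm : m < L.x) {k : ℕ} (hk : k < L.z)
    (hfree : ∀ c ∈ violatedCells p, c.2.2 ≠ 2 * k + 1) :
    ∑ i ∈ range (m + 1), ∑ j ∈ range (L.y + 1), syndrome p (2 * i, 2 * j, 2 * k + 1) =
      zCrossing p k := by
  rw [sum_range_succ', sum_eq_zero fun i hi => sum_eq_zero fun j hj => ?_, zero_add]
  · simp only [Nat.cast_zero, mul_zero, zCrossing]
  · rw [mem_range] at hi hj
    refine syndrome_eq_zero_of_notMem_violatedCells ?_ ?_ fun h => hfree _ h rfl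
    · rw [mem_qubitSites]; omega
    · simp only; omega

lemma yFlux_eq (hp : IsSymmetric p) (hm : m < L.x) (hfree : ∀ c ∈ violatedCells p, c.1 ≠ 2 * m + 2)
    {k : ℕ} (hk : k ≤ L.y) :
    ∑ i ∈ range (m + 2), ∑ l ∈ range L.z, syndrome p (2 * i - 1, 2 * k, 2 * l + 1) =
      ∑ i ∈ range (m + 2), ∑ l ∈ range L.z, syndrome p (2 * i - 1, 0, 2 * l + 1) := by
  have houtside {x y z : ℤ} (h : x < -1 ∨ z < 1 ∨ 2 * L.z - 1 < z)
      (hd : x % 2 + y % 2 + z % 2 = 2) : syndrome p (x, y, z) = 0 := by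
    refine syndrome_eq_zero_of_notMem_qubitSites p ?_ ?_
    · rw [mem_qubitSites]; omega
    · rintro ⟨x', y', z'⟩ hn
      rw [mem_neighbors] at hn
      rw [mem_qubitSites]
      omega
  refine sum_sum_eq_of_divergence_eq_zero (N := L.y)
    (F := fun k i l => syndrome p (2 * i - 1, 2 * k, 2 * l + 1))
    (G := fun k i l => syndrome p (2 * i - 2, 2 * k + 1, 2 * l + 1))
    (H := fun k i l => syndrome p (2 * i - 1, 2 * k + 1, 2 * l)) ?_ ?_ ?_ ?_ ?_ k hk
  · intro k hk i hi l hl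
    have h := hp.neighborSum_syndrome_cube (x := 2 * i - 1) (y := 2 * k + 1) (z := 2 * l + 1)
      (by rw [mem_cubes]; omega)
    rw [neighborSum_apply] at h
    rw [add_right_comm]
    simp only [CharTwo.sub_eq_add]
    convert h using 6 <;> push_cast <;> ring_nf
  · exact fun _ _ _ _ => houtside (by omega) (by omega)
  · intro k hk l hl
    refine syndrome_eq_zero_of_notMem_violatedCells ?_ ?_ fun h => hfree _ h ?_
    · rw [mem_qubitSites]; omega
    · simp only; omega
    · simp only; omega
  · exact fun _ _ _ _ => houtside (by omega) (by omega)
  · exact fun _ _ _ _ => houtside (by omega) (by omega)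

lemma syndrome_neg_one (p : PauliVec (Qubit L)) (y z : ℤ) :
    syndrome p (-1, y, z) = cellExt p.1 (0, y, z) := by
  have hzero (a : Config L) {x y z : ℤ} (hx : x < 0) : cellExt a (x, y, z) = 0 :=
    cellExt_eq_zero a (by rw [mem_qubitSites]; omega)
  have hneg : (-1 : ℤ) < 0 := by norm_num
  have hneg' : (-1 - 1 : ℤ) < 0 := by norm_num
  rw [syndrome_apply, neighborSum_apply, neg_add_cancel, hzero _ hneg, hzero _ hneg', hzero _ hneg,
    hzero _ hneg, hzero _ hneg, hzero _ hneg]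
  simp only [zero_add, add_zero]

lemma yFlux_eq_yCrossing (hm : m < L.x) {k : ℕ} (hk : k ≤ L.y)
    (hfree : ∀ c ∈ violatedCells p, c.2.1 ≠ 2 * k) :
    ∑ i ∈ range (m + 2), ∑ l ∈ range L.z, syndrome p (2 * i - 1, 2 * k, 2 * l + 1) =
      yCrossing p k := by
  rw [sum_range_succ', sum_eq_zero fun i hi => sum_eq_zero fun l hl => ?_, zero_add]
  · simp only [Nat.cast_zero, mul_zero, zero_sub, syndrome_neg_one, yCrossing]
  · rw [mem_range] at hi hl
    refine syndrome_eq_zero_of_notMem_violatedCells ?_ ?_ fun h => hfree _ h rfl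
    · rw [mem_qubitSites]; omega
    · simp only; omega

end Flux

section Crossings

lemma exists_lt_two_mul_add_notMem {s : Finset ℤ} {n : ℕ} (h : s.card < n) (ε : ℤ) :
    ∃ k < n, 2 * (k : ℤ) + ε ∉ s := by
  by_contra! hs
  have hinj : Function.Injective fun k : ℕ => 2 * (k : ℤ) + ε := fun a b hab => by
    simp only at hab; omega
  have hcard := card_le_card_of_injOn _ (fun k hk => hs k (mem_range.1 hk)) hinj.injOn
  rw [card_range] at hcard
  omega

lemma exists_lt_two_mul_add_notMem_of_dist_le {s : Finset ℤ} {t : Set ℤ} {r n : ℕ}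
    (ht : ∀ a ∈ t, ∀ b ∈ t, |a - b| ≤ 2 * r) (h : s.card + (4 * r + 3) < n) (ε : ℤ) :
    ∃ k < n, 2 * (k : ℤ) + ε ∉ s ∧ ∀ a ∈ t, 1 < |a - (2 * k + ε)| := by
  obtain rfl | ⟨c, hc⟩ := t.eq_empty_or_nonempty
  · obtain ⟨k, hk, hks⟩ := exists_lt_two_mul_add_notMem (s := s) (n := n) (by omega) ε
    exact ⟨k, hk, hks, fun a ha => ha.elim⟩
  · have hcard : (s ∪ Icc (c - 2 * r - 1) (c + 2 * r + 1)).card < n := by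
      have hIcc : (Icc (c - 2 * r - 1) (c + 2 * r + 1)).card = 4 * r + 3 := by
        rw [Int.card_Icc]; omega
      exact (card_union_le _ _).trans_lt (hIcc ▸ h)
    obtain ⟨k, hk, hks⟩ := exists_lt_two_mul_add_notMem hcard ε
    rw [mem_union, not_or, mem_Icc] at hks
    refine ⟨k, hk, hks.1, fun a ha => ?_⟩
    have hac := abs_le.1 (ht a ha c hc)
    rw [lt_abs]
    omega

variable {L : Dims} {p q : PauliVec (Qubit L)}

lemma zCrossing_eq_zCrossing (hp : IsSymmetric p) (hx : (violatedCells p).card < L.x) {k k' : ℕ}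
    (hk : k < L.z) (hk' : k' < L.z) (hfree : ∀ c ∈ violatedCells p, c.2.2 ≠ 2 * k + 1)
    (hfree' : ∀ c ∈ violatedCells p, c.2.2 ≠ 2 * k' + 1) : zCrossing p k = zCrossing p k' := by
  obtain ⟨m, hm, hplane⟩ :=
    exists_lt_two_mul_add_notMem (s := (violatedCells p).image (·.1)) (card_image_le.trans_lt hx) 1
  rw [← zFlux_eq_zCrossing hm hk hfree, ← zFlux_eq_zCrossing hm hk' hfree']
  have hm' (c) (hc : c ∈ violatedCells p) (h : c.1 = 2 * m + 1) : False :=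
    hplane (h ▸ mem_image_of_mem _ hc)
  rw [zFlux_eq hp hm hm' hk, zFlux_eq hp hm hm' hk']

lemma yCrossing_eq_yCrossing (hp : IsSymmetric p) (hx : (violatedCells p).card < L.x) {k k' : ℕ}
    (hk : k ≤ L.y) (hk' : k' ≤ L.y) (hfree : ∀ c ∈ violatedCells p, c.2.1 ≠ 2 * k)
    (hfree' : ∀ c ∈ violatedCells p, c.2.1 ≠ 2 * k') : yCrossing p k = yCrossing p k' := by
  obtain ⟨m, hm, hplane⟩ :=
    exists_lt_two_mul_add_notMem (s := (violatedCells p).image (·.1)) (card_image_le.trans_lt hx) 2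
  rw [← yFlux_eq_yCrossing hm hk hfree, ← yFlux_eq_yCrossing hm hk' hfree']
  have hm' (c) (hc : c ∈ violatedCells p) (h : c.1 = 2 * m + 2) : False :=
    hplane (h ▸ mem_image_of_mem _ hc)
  rw [yFlux_eq hp hm hm' hk, yFlux_eq hp hm hm' hk']

/-- The invariant of a symmetric local process of small energy: the excitations cross the toric code
facet an even number of times in each plane that contains no violated cluster term. In the other
planes the parity is not conserved. -/
structure HasEvenCrossings (p : PauliVec (Qubit L)) : Prop where
  zCrossing_eq_zero : ∀ k < L.z, (∀ c ∈ violatedCells p, c.2.2 ≠ 2 * k + 1) → zCrossing p k = 0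
  yCrossing_eq_zero : ∀ k ≤ L.y, (∀ c ∈ violatedCells p, c.2.1 ≠ 2 * k) → yCrossing p k = 0

lemma hasEvenCrossings_zero : HasEvenCrossings (0 : PauliVec (Qubit L)) where
  zCrossing_eq_zero k _ _ := sum_eq_zero fun j _ => by rw [map_zero, Pi.zero_apply]
  yCrossing_eq_zero k _ _ := sum_eq_zero fun l _ => by rw [Prod.fst_zero, map_zero, Pi.zero_apply]

lemma mem_violatedCells_of_add {c : Cell} (h : c ∈ violatedCells (p + q)) (hq : syndrome q c = 0) :
    c ∈ violatedCells p := by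
  rw [violatedCells, mem_filter, map_add, Pi.add_apply, hq, add_zero] at h
  exact mem_filter.2 h

lemma cellExt_eq_zero_of_forall {a : Config L} {A : Finset (Qubit L)} (ha : ∀ i ∉ A, a i = 0)
    {c : Cell} (hc : ∀ i ∈ A, i.1 ≠ c) : cellExt a c = 0 := by
  by_cases h : c ∈ qubitSites L
  · rw [cellExt_of_mem a h]
    exact ha _ fun hA => hc _ hA rfl
  · exact cellExt_eq_zero a h

lemma syndrome_eq_zero_of_far {A : Finset (Qubit L)} (hq : ∀ i ∉ A, q.1 i = 0 ∧ q.2 i = 0)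
    {c : Cell} (hc : ∀ i ∈ A, 1 < |i.1.2.1 - c.2.1| ∨ 1 < |i.1.2.2 - c.2.2|) :
    syndrome q c = 0 := by
  refine syndrome_eq_zero (cellExt_eq_zero_of_forall (fun i hi => (hq i hi).2) ?_)
    fun d hd => cellExt_eq_zero_of_forall (fun i hi => (hq i hi).1) ?_
  · rintro i hi rfl
    simpa only [sub_self, abs_zero, or_self, not_lt.2 zero_le_one] using hc i hi
  · rintro ⟨⟨x', y', z'⟩, hsite⟩ hi rfl
    obtain ⟨x, y, z⟩ := c
    have hdist := hc _ hi
    simp only [lt_abs] at hdist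
    rw [mem_neighbors] at hd
    omega

/-- A local step misses some plane without violations, where it cannot change the parity; by
conservation the parity is then the same in all planes without violations. -/
lemma HasEvenCrossings.add_of_local (hp : HasEvenCrossings p) (hpq : IsSymmetric (p + q))
    {A : Finset (Qubit L)} (hq : ∀ i ∉ A, q.1 i = 0 ∧ q.2 i = 0) {r : ℕ}
    (hA : ∀ i ∈ A, ∀ j ∈ A, |i.1.2.1 - j.1.2.1| ≤ 2 * r ∧ |i.1.2.2 - j.1.2.2| ≤ 2 * r)
    (hx : (violatedCells (p + q)).card < L.x)
    (hy : (violatedCells p).card + (4 * r + 3) < L.y)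
    (hz : (violatedCells p).card + (4 * r + 3) < L.z) : HasEvenCrossings (p + q) where
  zCrossing_eq_zero k hk hfree := by
    obtain ⟨n, hn, hnp, hnA⟩ := exists_lt_two_mul_add_notMem_of_dist_le
      (s := (violatedCells p).image (·.2.2)) (t := (fun i : Qubit L => i.1.2.2) '' A)
      (by rintro _ ⟨i, hi, rfl⟩ _ ⟨j, hj, rfl⟩; exact (hA i hi j hj).2)
      ((Nat.add_le_add_right card_image_le _).trans_lt hz) 1
    have hzero {c : Cell} (hc : c.2.2 = 2 * n + 1) : syndrome q c = 0 :=
      syndrome_eq_zero_of_far hq fun i hi => Or.inr (hc ▸ hnA _ ⟨i, hi, rfl⟩)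
    have hfree' (c) (hc : c ∈ violatedCells p) (h : c.2.2 = 2 * n + 1) : False :=
      hnp (h ▸ mem_image_of_mem _ hc)
    rw [zCrossing_eq_zCrossing hpq hx hk hn hfree fun c hc h =>
        hfree' c (mem_violatedCells_of_add hc (hzero h)) h, zCrossing_add,
      hp.zCrossing_eq_zero n hn hfree', zero_add]
    exact sum_eq_zero fun j _ => hzero rfl
  yCrossing_eq_zero k hk hfree := by
    obtain ⟨n, hn, hnp, hnA⟩ := exists_lt_two_mul_add_notMem_of_dist_le
      (s := (violatedCells p).image (·.2.1)) (t := (fun i : Qubit L => i.1.2.1) '' A)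
      (by rintro _ ⟨i, hi, rfl⟩ _ ⟨j, hj, rfl⟩; exact (hA i hi j hj).1)
      ((Nat.add_le_add_right card_image_le _).trans_lt hy) 0
    rw [add_zero] at hnp hnA
    have hzero {c : Cell} (hc : c.2.1 = 2 * n) : syndrome q c = 0 :=
      syndrome_eq_zero_of_far hq fun i hi => Or.inl (hc ▸ hnA _ ⟨i, hi, rfl⟩)
    have hfree' (c) (hc : c ∈ violatedCells p) (h : c.2.1 = 2 * n) : False :=
      hnp (h ▸ mem_image_of_mem _ hc)
    rw [yCrossing_eq_yCrossing hpq hx hk hn.le hfree fun c hc h =>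
        hfree' c (mem_violatedCells_of_add hc (hzero h)) h, yCrossing_add,
      hp.yCrossing_eq_zero n hn.le hfree', zero_add]
    exact sum_eq_zero fun l _ => (syndrome_neg_one q _ _).symm.trans (hzero rfl)

end Crossings

section Barrier

variable {L : Dims}

lemma isSymmetric_of_commute {c : ℂ} (hc : c ≠ 0) {p : PauliVec (Qubit L)}
    (h : ∀ g ∈ symGroup L, Commute (c • pauli p) g) : IsSymmetric p := by
  have hopX {S : Finset (Qubit L)} {d : Cell} (hS : ∀ i, i ∈ S ↔ i.1 ∈ neighbors d)
      (hmem : opX S ∈ symGroup L) : neighborSum (cellExt p.2) d = 0 := by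
    have hcomm := commForm_eq_zero_of_commute hc (opX_eq_pauli S ▸ h _ hmem)
    rwa [commForm_apply, dotProduct_zero, zero_add, dotProduct_ind_eq_neighborSum _ hS] at hcomm
  intro d hd
  obtain hd | hd := mem_union.1 hd
  · have hdim : cellDim d = 0 := (mem_filter.1 hd).2.1
    refine hopX (fun i => ?_) (Submonoid.subset_closure (Or.inl ⟨d, hd, rfl⟩))
    rw [mem_filter, and_iff_right (mem_univ i), cellDim_one_and_inside_iff hdim]
  · have hdim : cellDim d = 2 + 1 := (mem_filter.1 hd).2
    refine hopX (fun i => ?_) (Submonoid.subset_closure (Or.inr ⟨d, hd, rfl⟩))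
    rw [mem_filter, and_iff_right (mem_univ i), cellDim_and_inside_iff hdim (by norm_num)]

lemma violatedCells_card_le_hammingNorm (p : PauliVec (Qubit L)) :
    (violatedCells p).card ≤ hammingNorm fun t : Term L => commForm p (termVec t) := by
  have himage : violatedCells p ⊆ ({t : Term L | commForm p (termVec t) ≠ 0} : Finset _).image
      (Sum.elim (fun i => i.1.1) fun _ => 0) := by
    intro c hc
    obtain ⟨hsite, hx, hc⟩ := mem_filter.1 hc
    refine mem_image.2 ⟨.inl ⟨⟨c, hsite⟩, mem_bulkQubits.2 hx⟩, ?_, rfl⟩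
    rw [mem_filter, termVec_cluster, commForm_clusterVec]
    exact ⟨mem_univ _, hc⟩
  exact (card_le_card himage).trans card_image_le

lemma violatedCells_eq_empty {p : PauliVec (Qubit L)}
    (hp : ∀ t : Term L, commForm p (termVec t) = 0) : violatedCells p = ∅ := by
  rw [← card_eq_zero, ← Nat.le_zero]
  refine (violatedCells_card_le_hammingNorm p).trans_eq (hammingNorm_eq_zero.2 (funext hp))

lemma HasEvenCrossings.not_isLogical (hx : 1 ≤ L.x) {p : PauliVec (Qubit L)}
    (hp : HasEvenCrossings p) {c : ℂ} (hc : c ≠ 0) :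
    ¬ IsLogical (hamiltonian L) (c • pauli p) := by
  rw [hamiltonian_eq_stabilizerHamiltonian]
  rintro ⟨-, hpreserves, hscalar⟩
  have hcomm := (isStabilizerFamily_termVec L).commForm_eq_zero_of_preserves hc hpreserves
  have hfree {P : Cell → Prop} (d) (hd : d ∈ violatedCells p) : P d := by
    rw [violatedCells_eq_empty hcomm] at hd
    exact absurd hd (notMem_empty d)
  have hspan := mem_span_range_termVec hx hcomm (fun k hk => hp.yCrossing_eq_zero k hk hfree)
    fun k hk => hp.zCrossing_eq_zero k hk hfree
  exact hscalar ((isStabilizerFamily_termVec L).exists_smul_of_mem_span hspan c)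

lemma HasEvenCrossings.exists_mul_eq_smul_pauli {p : PauliVec (Qubit L)} (hp : HasEvenCrossings p)
    {r : ℕ} {c : ℂ} {P : Op L} (hc : c ≠ 0) (hP : IsLocalPauli r P)
    (hsym : ∀ g ∈ symGroup L, Commute (P * c • pauli p) g)
    (hcard : (violatedCells p).card + (4 * r + 3) < min L.x (min L.y L.z))
    (hcard' : ∀ (d : ℂ) (q : PauliVec (Qubit L)), d ≠ 0 → P * c • pauli p = d • pauli q →
      (violatedCells q).card + (4 * r + 3) < min L.x (min L.y L.z)) :
    ∃ (d : ℂ) (q : PauliVec (Qubit L)), d ≠ 0 ∧ P * c • pauli p = d • pauli q ∧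
      HasEvenCrossings q := by
  obtain ⟨A, hPA, hA⟩ := hP
  obtain ⟨b, s, hb, rfl, hs⟩ := hPA.exists_eq_smul_pauli
  have hmul : (b • pauli s) * c • pauli p = (b * c * sgn (s.2 ⬝ᵥ p.1)) • pauli (p + s) := by
    rw [smul_mul_smul_comm, pauli_mul, smul_smul, add_comm]
  have hd : b * c * sgn (s.2 ⬝ᵥ p.1) ≠ 0 :=
    mul_ne_zero (mul_ne_zero hb hc) (sgn.val_isUnit _).ne_zero
  have hlow := hcard' _ _ hd hmul
  exact ⟨_, _, hd, hmul, hp.add_of_local (isSymmetric_of_commute hd (hmul ▸ hsym)) hs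
    (fun i hi j hj => (hA i hi j hj).2) (by omega) (by omega) (by omega)⟩

lemma exists_le_card_violatedCells (hx : 1 ≤ L.x) {r : ℕ} {l : Op L}
    (hl : IsLogical (hamiltonian L) l) {N : ℕ} {p : Fin (N + 1) → Op L}
    (hp : IsSymLocalDecomp (symGroup L) r l p) :
    ∃ (k : Fin (N + 1)) (c : ℂ) (q : PauliVec (Qubit L)), c ≠ 0 ∧ p k = c • pauli q ∧
      min L.x (min L.y L.z) ≤ (violatedCells q).card + (4 * r + 3) := by
  by_contra! hlow
  have heven (k : Fin (N + 1)) : ∃ (c : ℂ) (q : PauliVec (Qubit L)), c ≠ 0 ∧ p k = c • pauli q ∧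
      HasEvenCrossings q := by
    induction k using Fin.induction with
    | zero =>
      exact ⟨1, 0, one_ne_zero, by rw [hp.first, pauli_zero, one_smul], hasEvenCrossings_zero⟩
    | succ k ih =>
      obtain ⟨c, q, hc, hpk, hq⟩ := ih
      obtain ⟨P, hP, hstep⟩ := hp.step k
      rw [hpk] at hstep
      rw [hstep]
      exact hq.exists_mul_eq_smul_pauli hc hP (hstep ▸ hp.symmetric _) (hlow _ c q hc hpk)
        (hstep ▸ hlow k.succ)
  obtain ⟨c, q, hc, hpk, hq⟩ := heven (Fin.last N)
  rw [hp.last] at hpk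
  exact hq.not_isLogical hx hc (hpk ▸ hl)

theorem le_symEnergyBarrier (hx : 1 ≤ L.x) (r : ℕ) :
    ((2 * ((min L.x (min L.y L.z) : ℕ) - (4 * r + 3)) : ℝ) : EReal) ≤
      symEnergyBarrier (hamiltonian L) (symGroup L) r := by
  refine le_iInf₂ fun l hl => le_iInf₂ fun N p => le_iInf fun hp => ?_
  obtain ⟨k, c, q, hc, hpk, hq⟩ := exists_le_card_violatedCells hx hl hp
  have henergy := (isStabilizerFamily_termVec L).hasEnergy_smul_pauli hc q
  rw [← hamiltonian_eq_stabilizerHamiltonian, ← hpk] at henergy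
  refine le_iSup_of_le k (le_iSup₂_of_le _ henergy ?_)
  rw [EReal.coe_le_coe_iff, hamiltonian_eq_stabilizerHamiltonian,
    (isStabilizerFamily_termVec L).groundEnergy_eq]
  have hmin : ((min L.x (min L.y L.z) : ℕ) : ℝ) ≤
      (hammingNorm fun t : Term L => commForm q (termVec t) : ℕ) + (4 * r + 3) := by
    exact_mod_cast hq.trans (Nat.add_le_add_right (violatedCells_card_le_hammingNorm q) _)
  linarith

end Barrier

section Width

lemma walkDist_le {Γ : SimpleGraph Cell} {A B : Set Cell} {s : ℕ → Cell} {n : ℕ}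
    (h : ∀ k < n, Γ.Adj (s k) (s (k + 1))) (hA : s 0 ∈ A) (hB : s n ∈ B) :
    walkDist Γ A B ≤ n := by
  have hwalk (m : ℕ) (hm : m ≤ n) : ∃ w : Γ.Walk (s 0) (s m), w.length = m := by
    induction m with
    | zero => exact ⟨.nil, rfl⟩
    | succ m ih =>
      obtain ⟨w, hw⟩ := ih (by omega)
      exact ⟨w.concat (h m (by omega)), by rw [SimpleGraph.Walk.length_concat, hw]⟩
  obtain ⟨w, hw⟩ := hwalk n le_rfl
  exact Nat.sInf_le ⟨_, hA, _, hB, w, hw⟩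

variable {L : Dims}

lemma dZ_le (hx : 1 ≤ L.x) : dZ L ≤ L.z := by
  refine walkDist_le (s := fun k => (0, 0, 2 * k)) (fun k hk => ?_) ?_ ?_
  · rw [latticeGraph, SimpleGraph.fromRel_adj]
    refine ⟨by simp, Or.inl ⟨by simp only [cellDim]; omega, by simp only [cellDim]; omega,
      (0, 0, 2 * k + 1), by rw [mem_edges]; omega, ?_, ?_⟩⟩ <;> rw [inside_iff] <;> omega
  · simp [cellDim]
  · exact ⟨by simp only [cellDim]; omega, rfl, rfl⟩

lemma dX_le (hx : 1 ≤ L.x) (hz : 1 ≤ L.z) : dX L ≤ L.y + 1 := by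
  refine walkDist_le (s := fun k => (0, 2 * k - 1, 1)) (fun k hk => ?_) ?_ ?_
  · rw [toricDualGraph, SimpleGraph.fromRel_adj]
    refine ⟨by simp, Or.inl ⟨⟨by simp only [cellDim]; omega, rfl⟩,
      ⟨by simp only [cellDim]; omega, rfl⟩,
      (0, 2 * k, 1), by rw [mem_edges]; omega, rfl, ?_, ?_⟩⟩ <;> rw [inside_iff] <;> omega
  · simp [cellDim]
  · exact ⟨by simp only [cellDim]; omega, rfl, by push_cast; ring⟩

lemma dCond_le (hz : 2 ≤ L.z) : dCond L ≤ L.x := by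
  refine walkDist_le (s := fun k => (2 * k, 0, 2)) (fun k hk => ?_) ?_ ?_
  · rw [latticeGraph, SimpleGraph.fromRel_adj]
    refine ⟨by simp, Or.inl ⟨by simp only [cellDim]; omega, by simp only [cellDim]; omega,
      (2 * k + 1, 0, 2), by rw [mem_edges]; omega, ?_, ?_⟩⟩ <;> rw [inside_iff] <;> omega
  · simp [cellDim]
  · exact ⟨by simp only [cellDim]; omega, rfl⟩

lemma latticeWidth_le (hx : 1 ≤ L.x) (hz : 2 ≤ L.z) :
    latticeWidth L ≤ min L.x (min L.y L.z) + 1 := by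
  have hdZ := dZ_le hx
  have hdX := dX_le hx (one_le_two.trans hz)
  have hdCond := dCond_le hz
  unfold latticeWidth
  omega

end Width

end RBH

end

theorem mainTheorem1 (r : ℕ) :
    ∃ r' : ℝ,
      (∀ L : RBH.Dims, 1 ≤ L.x → 1 ≤ L.y → 2 ≤ L.z →
        RBH.energyGap (RBH.hamiltonian L) = 2 ∧
        (((RBH.latticeWidth L : ℝ) * (RBH.energyGap (RBH.hamiltonian L) / 2) - r' : ℝ) : EReal) ≤
          RBH.symEnergyBarrier (RBH.hamiltonian L) (RBH.symGroup L) r) ∧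
      (∀ n : ℕ, 2 ≤ n →
        (((n : ℝ) * (RBH.energyGap (RBH.hamiltonian ⟨n, n, n⟩) / 2) - r' : ℝ) : EReal) ≤
          RBH.symEnergyBarrier (RBH.hamiltonian ⟨n, n, n⟩) (RBH.symGroup ⟨n, n, n⟩) r) := by
  refine ⟨8 * r + 7, fun L hx _ hz => ?_, fun n hn => ?_⟩
  · have hgap := RBH.energyGap_hamiltonian hx (one_le_two.trans hz)
    refine ⟨hgap, (EReal.coe_le_coe ?_).trans (RBH.le_symEnergyBarrier hx r)⟩
    have hwidth : (RBH.latticeWidth L : ℝ) ≤ (min L.x (min L.y L.z) : ℕ) + 1 := by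
      exact_mod_cast RBH.latticeWidth_le hx hz
    rw [hgap]
    linarith [Nat.cast_nonneg (α := ℝ) (min L.x (min L.y L.z))]
  · have hn₁ : 1 ≤ n := one_le_two.trans hn
    refine (EReal.coe_le_coe ?_).trans (RBH.le_symEnergyBarrier (L := ⟨n, n, n⟩) hn₁ r)
    rw [RBH.energyGap_hamiltonian (L := ⟨n, n, n⟩) hn₁ hn₁, min_self, min_self]
    linarith [Nat.cast_nonneg (α := ℝ) n]
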